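/- Let $X=\mathbb{P}^1\times\mathbb{P}^1$ over $\mathbb{C}$, with homogeneous coordinates $(x_0:x_1)$ and $(y_0:y_1)$ on the two factors. Let $S=\mathbb{C}[x_0,x_1,y_0,y_1]$ be bigraded by $\deg x_i=(1,0)$, $\deg y_j=(0,1)$. For $m,n\in\mathbb{Z}$ let $S_{m,n}$ be its summand of bidegree $(m,n)$, identified with a space of global sections of $\mathcal{O}_X(m,n)=\mathcal{O}_{\mathbb{P}^1}(m)\boxtimes\mathcal{O}_{\mathbb{P}^1}(n)$, and for an ideal $I\subseteq S$ let $I_{m,n}=I\cap S_{m,n}$. Let $d,e\in\mathbb{Z}$, let $L=\mathcal{O}_X(d,e)$, and let $F\in S_{d,e}\subseteq H^0(X,L)$ be an irreducible polynomial. Let $\Sigma_L$ be the vector bundle of differential operators of order at most one from $L$ to $L$. For $a,b\in\mathbb{Z}$ put $M=\mathcal{O}_X(a,b)$, and let $$J_{a,b}:=\operatorname{im}\bigl(dF\colon H^0(X,\Sigma_L\otimes L^\vee\otimes M)\longrightarrow H^0(X,M)\bigr)$$ be the generalized Jacobian ideal in degree $M$, where $dF\colon\Sigma_L\otimes L^\vee\otimes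 M\to M$ is obtained by tensoring the evaluation map $\Sigma_L\to L$, $D\mapsto D(F)$, with the identity of $L^\vee\otimes M=\mathcal{O}_X(a-d,b-e)$. Then, for all $a,b\in\mathbb{Z}$, $$J_{a,b}=\left(\frac{\partial F}{\partial x_0},\frac{\partial F}{\partial x_1},\frac{\partial F}{\partial y_0},\frac{\partial F}{\partial y_1}\right)_{a,b}$$ $$=\left\{P_0\frac{\partial F}{\partial x_0}+P_1\frac{\partial F}{\partial x_1}+Q_0\frac{\partial F}{\partial y_0}+Q_1\frac{\partial F}{\partial y_1}\ \middle|\ P_0,P_1\in S_{a-d+1,b-e},\ Q_0,Q_1\in S_{a-d,b-e+1}\right\}.$$ -/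

import Mathlib

noncomputable section

namespace P1P1

open scoped TensorProduct

/-! ### The bigraded coordinate ring and the points of `ℙ¹ × ℙ¹` -/

/-- The polynomial ring `ℂ[x₀, x₁, y₀, y₁]`; `x i = X (Sum.inl i)` and `y j = X (Sum.inr j)`. -/
abbrev S : Type := MvPolynomial (Fin 2 ⊕ Fin 2) ℂ

/-- The variables `x₀, x₁` have bidegree `(1, 0)` and `y₀, y₁` have bidegree `(0, 1)`. -/
def bidegree : Fin 2 ⊕ Fin 2 → ℤ × ℤ := Sum.elim (fun _ => (1, 0)) (fun _ => (0, 1))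

/-- The space `S_{m,n}` of bihomogeneous polynomials of bidegree `(m, n)`
(it is zero if `m` or `n` is negative). -/
def bihom (m n : ℤ) : Submodule ℂ S := MvPolynomial.weightedHomogeneousSubmodule ℂ bidegree (m, n)

/-- The closed points of the variety `ℙ¹ × ℙ¹` over `ℂ`. -/
abbrev Pt : Type := Projectivization ℂ (Fin 2 → ℂ) × Projectivization ℂ (Fin 2 → ℂ)

/-- The value of a polynomial at chosen homogeneous coordinates of `P`. For a bihomogeneous
polynomial, whether it is zero does not depend on the choice of the coordinates. -/
def valAt (P : Pt) : S →+* ℂ := MvPolynomial.eval (Sum.elim P.1.rep P.2.rep)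

/-- Zariski open subsets of `ℙ¹ × ℙ¹`: the complements of the common zero loci of sets of
bihomogeneous polynomials. -/
def IsZariskiOpen (U : Set Pt) : Prop :=
  ∃ T : Set S, (∀ h ∈ T, ∃ i j : ℤ, h ∈ bihom i j) ∧ U = {P | ∃ h ∈ T, valAt P h ≠ 0}

/-! ### The line bundles `𝒪(m, n)`

The variety is irreducible, so that every locally free sheaf is a subsheaf of the constant sheaf
(on nonempty open sets) given by its stalk at the generic point. -/

/-- The field of fractions of `S`. -/
def K : Type := FractionRing S

instance : Field K := inferInstanceAs (Field (FractionRing S))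

instance : CommRing K := Field.toCommRing

instance : CommSemiring K := CommRing.toCommSemiring

instance : Semiring K := CommSemiring.toSemiring

instance : Algebra S K := inferInstanceAs (Algebra S (FractionRing S))

instance : IsFractionRing S K := inferInstanceAs (IsFractionRing S (FractionRing S))

instance : Algebra ℂ K := inferInstanceAs (Algebra ℂ (FractionRing S))

instance : IsScalarTower ℂ S K := inferInstanceAs (IsScalarTower ℂ S (FractionRing S))

theorem bihom_mul {m n m' n' : ℤ} {p q : S} (hp : p ∈ bihom m n) (hq : q ∈ bihom m' n') :
    p * q ∈ bihom (m + m') (n + n') := by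
  have h := MvPolynomial.IsWeightedHomogeneous.mul
    ((MvPolynomial.mem_weightedHomogeneousSubmodule _ _ _ _).1 hp)
    ((MvPolynomial.mem_weightedHomogeneousSubmodule _ _ _ _).1 hq)
  exact (MvPolynomial.mem_weightedHomogeneousSubmodule _ _ _ _).2 h

theorem one_mem_bihom : (1 : S) ∈ bihom 0 0 :=
  (MvPolynomial.mem_weightedHomogeneousSubmodule _ _ _ _).2
    (MvPolynomial.isWeightedHomogeneous_one ℂ bidegree)

/-- `r` is a quotient `p / q` of bihomogeneous polynomials whose bidegrees differ by `(m, n)` and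
whose denominator satisfies `good`. -/
def IsQuot (good : S → Prop) (m n : ℤ) (r : K) : Prop :=
  ∃ (i j : ℤ) (p q : S), p ∈ bihom (i + m) (j + n) ∧ q ∈ bihom i j ∧ q ≠ 0 ∧ good q ∧
    r = algebraMap S K p / algebraMap S K q

theorem IsQuot.of_poly {good : S → Prop} (h1 : good 1) {m n : ℤ} {p : S} (hp : p ∈ bihom m n) :
    IsQuot good m n (algebraMap S K p) :=
  ⟨0, 0, p, 1, by simpa using hp, one_mem_bihom, one_ne_zero, h1, by simp⟩

theorem IsQuot.add {good : S → Prop} (hm : ∀ p q, good p → good q → good (p * q)) {m n : ℤ}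
    {r s : K} (hr : IsQuot good m n r) (hs : IsQuot good m n s) : IsQuot good m n (r + s) := by
  obtain ⟨i, j, p, q, hp, hq, hq0, hg, rfl⟩ := hr
  obtain ⟨i', j', p', q', hp', hq', hq0', hg', rfl⟩ := hs
  refine ⟨i + i', j + j', p * q' + q * p', q * q', ?_, bihom_mul hq hq', mul_ne_zero hq0 hq0',
    hm _ _ hg hg', ?_⟩
  · refine Submodule.add_mem _ ?_ ?_
    · rw [add_right_comm i i' m, add_right_comm j j' n]
      exact bihom_mul hp hq'
    · rw [add_assoc i i' m, add_assoc j j' n]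
      exact bihom_mul hq hp'
  · have h1 : algebraMap S K q ≠ 0 := by simpa using hq0
    have h2 : algebraMap S K q' ≠ 0 := by simpa using hq0'
    rw [map_add, map_mul, map_mul, map_mul, div_add_div _ _ h1 h2]

theorem IsQuot.mul {good : S → Prop} (hm : ∀ p q, good p → good q → good (p * q))
    {m n m' n' m'' n'' : ℤ} (h1 : m + m' = m'') (h2 : n + n' = n'')
    {r s : K} (hr : IsQuot good m n r) (hs : IsQuot good m' n' s) :
    IsQuot good m'' n'' (r * s) := by
  obtain ⟨i, j, p, q, hp, hq, hq0, hg, rfl⟩ := hr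
  obtain ⟨i', j', p', q', hp', hq', hq0', hg', rfl⟩ := hs
  refine ⟨i + i', j + j', p * p', q * q', ?_, bihom_mul hq hq', mul_ne_zero hq0 hq0',
    hm _ _ hg hg', ?_⟩
  · subst h1 h2
    rw [add_add_add_comm i i' m m', add_add_add_comm j j' n n']
    exact bihom_mul hp hp'
  · rw [map_mul, map_mul, div_mul_div_comm]

theorem algebraMap_const (c : ℂ) : algebraMap S K (MvPolynomial.C c) = algebraMap ℂ K c := by
  rw [IsScalarTower.algebraMap_apply ℂ S K, MvPolynomial.algebraMap_eq]

theorem IsQuot.const {good : S → Prop} (h1 : good 1) (c : ℂ) :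
    IsQuot good 0 0 (algebraMap ℂ K c) := by
  rw [← algebraMap_const]
  exact IsQuot.of_poly h1 ((MvPolynomial.mem_weightedHomogeneousSubmodule _ _ _ _).2
    (MvPolynomial.isWeightedHomogeneous_C bidegree c))

/-- Every nonzero denominator is allowed. -/
def anyDen : S → Prop := fun _ => True

/-- The denominator does not vanish at `P`. -/
def nonzeroAt (P : Pt) : S → Prop := fun q => valAt P q ≠ 0

theorem anyDen_one : anyDen 1 := trivial

theorem anyDen_mul (p q : S) (_ : anyDen p) (_ : anyDen q) : anyDen (p * q) := trivial

theorem nonzeroAt_one (P : Pt) : nonzeroAt P 1 := by simp [nonzeroAt]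

theorem nonzeroAt_mul (P : Pt) (p q : S) (hp : nonzeroAt P p) (hq : nonzeroAt P q) :
    nonzeroAt P (p * q) := by
  unfold nonzeroAt at *
  rw [map_mul]
  exact mul_ne_zero hp hq

/-- The function field of `ℙ¹ × ℙ¹`: the quotients of bihomogeneous polynomials of the same
bidegree. -/
def funField : Subalgebra ℂ K where
  carrier := {r | IsQuot anyDen 0 0 r}
  mul_mem' hr hs := IsQuot.mul anyDen_mul (add_zero 0) (add_zero 0) hr hs
  add_mem' hr hs := IsQuot.add anyDen_mul hr hs
  algebraMap_mem' c := IsQuot.const anyDen_one c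

instance : CommRing funField := Subalgebra.toCommRing funField

instance : CommSemiring funField := CommRing.toCommSemiring

instance : Semiring funField := CommSemiring.toSemiring

instance : Algebra ℂ funField := Subalgebra.algebra funField

instance : Module funField K := inferInstance

/-- The stalk of `𝒪(m, n)` at the generic point (the rational sections of `𝒪(m, n)`), a
one-dimensional vector space over the function field. -/
def ratSec (m n : ℤ) : Submodule funField K where
  carrier := {r | IsQuot anyDen m n r}
  add_mem' hr hs := IsQuot.add anyDen_mul hr hs
  zero_mem' := by
    have h := IsQuot.of_poly (good := anyDen) anyDen_one (Submodule.zero_mem (bihom m n))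
    rwa [map_zero] at h
  smul_mem' g r hr := by
    rw [Subalgebra.smul_def]
    exact IsQuot.mul anyDen_mul (zero_add m) (zero_add n) g.2 hr

instance (m n : ℤ) : AddCommGroup (ratSec m n) := Submodule.addCommGroup (ratSec m n)

instance (m n : ℤ) : Module funField (ratSec m n) := Submodule.module (ratSec m n)

instance (m n : ℤ) : Module ℂ (ratSec m n) := Submodule.module' (ratSec m n)

instance (m n : ℤ) : AddCommMonoid (ratSec m n) := AddCommGroup.toAddCommMonoid

instance (m n : ℤ) : SMul funField (ratSec m n) := (inferInstance : Module funField _).toSMul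

instance (m n : ℤ) : SMul ℂ (ratSec m n) := (inferInstance : Module ℂ _).toSMul

instance (m n : ℤ) : IsScalarTower ℂ funField (ratSec m n) :=
  Submodule.isScalarTower (ratSec m n)

instance (m n : ℤ) : SMulCommClass ℂ funField (ratSec m n) where
  smul_comm c g r := by
    apply Subtype.ext
    change c • ((g : K) * (r : K)) = (g : K) * (c • (r : K))
    exact (mul_smul_comm c (g : K) (r : K)).symm

instance (d e : ℤ) : Module funField (ratSec d e →ₗ[ℂ] ratSec d e) := LinearMap.module

/-- The rational section `r` of `𝒪(m, n)` is regular at the point `P`. -/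
def RegularAt (P : Pt) {m n : ℤ} (r : ratSec m n) : Prop := IsQuot (nonzeroAt P) m n (r : K)

/-- The sections of the line bundle `𝒪(m, n)` over a nonempty open set `U`. -/
def sec (m n : ℤ) (U : Set Pt) : Submodule ℂ (ratSec m n) where
  carrier := {r | ∀ P ∈ U, RegularAt P r}
  add_mem' hr hs P hP := IsQuot.add (nonzeroAt_mul P) (hr P hP) (hs P hP)
  zero_mem' P _ := by
    have h := IsQuot.of_poly (nonzeroAt_one P) (Submodule.zero_mem (bihom m n))
    rwa [map_zero] at h
  smul_mem' c r hr P hP := by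
    have h := IsQuot.mul (nonzeroAt_mul P) (zero_add m) (zero_add n)
      (IsQuot.const (nonzeroAt_one P) c) (hr P hP)
    rwa [← Algebra.smul_def] at h

/-- The global sections `H⁰(𝒪(m, n))`. -/
abbrev H0 (m n : ℤ) : Submodule ℂ (ratSec m n) := sec m n Set.univ

/-- A bihomogeneous polynomial of bidegree `(m, n)`, as a global section of `𝒪(m, n)`. -/
def polySec (m n : ℤ) : bihom m n →ₗ[ℂ] H0 m n where
  toFun p := ⟨⟨algebraMap S K p, IsQuot.of_poly anyDen_one p.2⟩,
    fun P _ => IsQuot.of_poly (nonzeroAt_one P) p.2⟩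
  map_add' p q := by
    apply Subtype.ext
    apply Subtype.ext
    exact map_add (algebraMap S K) (p : S) (q : S)
  map_smul' c p := by
    apply Subtype.ext
    apply Subtype.ext
    change algebraMap S K (c • (p : S)) = c • algebraMap S K (p : S)
    rw [Algebra.algebraMap_eq_smul_one, smul_assoc, ← Algebra.algebraMap_eq_smul_one]

/-! ### The bundle `Σ_L` of first-order differential operators on `L = 𝒪(d, e)` -/

/-- The stalk of `Σ_L` at the generic point, for `L = 𝒪(d, e)`: the `ℂ`-linear operators `D` on the
rational sections of `L` that are differential operators of order at most one, that is, those for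
which the commutators `[[D, g], h]` with all rational functions `g`, `h` vanish. Rational
functions act by `(g • D) f = g • D f`. -/
def ratSigma (d e : ℤ) : Submodule funField (ratSec d e →ₗ[ℂ] ratSec d e) where
  carrier := {D | ∀ (g h : funField) (f : ratSec d e),
    D (g • h • f) - g • D (h • f) - h • D (g • f) + g • h • D f = 0}
  add_mem' {D D'} hD hD' g h f := by
    have h1 := hD g h f
    have h2 := hD' g h f
    simp only [LinearMap.add_apply, smul_add]
    rw [← add_zero (0 : ratSec d e)]
    nth_rewrite 1 [← h1]
    rw [← h2]
    abel
  zero_mem' g h f := by simp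
  smul_mem' k D hD g h f := by
    have h1 := congrArg (fun z => k • z) (hD g h f)
    simp only [smul_add, smul_sub, smul_zero] at h1
    simp only [LinearMap.smul_apply]
    rw [smul_comm g k, smul_comm h k, smul_comm h k (D f), smul_comm g k]
    exact h1

instance (d e : ℤ) : AddCommGroup (ratSigma d e) := Submodule.addCommGroup (ratSigma d e)

instance (d e : ℤ) : Module funField (ratSigma d e) := Submodule.module (ratSigma d e)

/-- The sections of `Σ_L` over a nonempty open set `U`: the first-order differential operators that
map sections of `L` over `V` to sections of `L` over `V`, for every open `V ⊆ U`. -/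
def sigmaSec (d e : ℤ) (U : Set Pt) : Set (ratSigma d e) :=
  {D | ∀ V : Set Pt, IsZariskiOpen V → V ⊆ U → ∀ f ∈ sec d e V, D.1 f ∈ sec d e V}

instance (d e : ℤ) : IsScalarTower ℂ funField (ratSec d e →ₗ[ℂ] ratSec d e) where
  smul_assoc c g D := by
    ext f
    exact congrArg Subtype.val (smul_assoc c g (D f))

instance (d e : ℤ) : Module ℂ (ratSigma d e) := Submodule.module' (ratSigma d e)

instance (d e : ℤ) : IsScalarTower ℂ funField (ratSigma d e) :=
  Submodule.isScalarTower (ratSigma d e)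

instance (d e : ℤ) : SMulCommClass funField ℂ (ratSigma d e) :=
  IsScalarTower.to_smulCommClass'

instance (d e m n : ℤ) : Module ℂ (ratSigma d e ⊗[funField] ratSec m n) :=
  TensorProduct.leftModule

instance (d e m n : ℤ) : IsScalarTower ℂ funField (ratSigma d e ⊗[funField] ratSec m n) :=
  TensorProduct.isScalarTower_left

/-- The global sections `H⁰(Σ_L ⊗ 𝒪(m, n))`, for `L = 𝒪(d, e)`: the elements of the generic stalk of
the tensor product that are, in a neighbourhood `V` of every point, finite sums of tensors `D ⊗ r`
with sections `D` of `Σ_L` and `r` of `𝒪(m, n)` over `V`. -/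
def H0Sigma (d e m n : ℤ) : Submodule ℂ (ratSigma d e ⊗[funField] ratSec m n) :=
  ⨅ P : Pt, Submodule.span ℂ {t | ∃ V : Set Pt, IsZariskiOpen V ∧ P ∈ V ∧
    ∃ D ∈ sigmaSec d e V, ∃ r ∈ sec m n V, t = D ⊗ₜ[funField] r}

/-! ### The differential of a section, and the Jacobian ideals -/

/-- The differential of a rational section `σ` of `L = 𝒪(d, e)`, twisted by the identity of
`M ⊗ L^∨ = 𝒪(a - d, b - e)`, at the generic point: the map
`Σ_L ⊗ M ⊗ L^∨ → L ⊗ M ⊗ L^∨ = M = 𝒪(a, b)` that sends `D ⊗ r` to `D(σ) r`. -/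
def ratDiff {d e : ℤ} (a b : ℤ) (σ : ratSec d e) :
    ratSigma d e ⊗[funField] ratSec (a - d) (b - e) →ₗ[funField] ratSec a b :=
  TensorProduct.lift (LinearMap.mk₂ funField
    (fun D r => (⟨(D.1 σ : K) * (r : K), IsQuot.mul anyDen_mul (add_sub_cancel d a)
      (add_sub_cancel e b) (D.1 σ).2 r.2⟩ : ratSec a b))
    (fun D D' r => Subtype.ext (add_mul (D.1 σ : K) (D'.1 σ : K) (r : K)))
    (fun g D r => Subtype.ext (mul_assoc (g : K) (D.1 σ : K) (r : K)))
    (fun D r r' => Subtype.ext (mul_add (D.1 σ : K) (r : K) (r' : K)))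
    (fun g D r => Subtype.ext (mul_left_comm (D.1 σ : K) (g : K) (r : K))))

theorem ratDiff_mem {d e : ℤ} (a b : ℤ) (σ : H0 d e) :
    ∀ t ∈ H0Sigma d e (a - d) (b - e), (ratDiff a b σ.1).restrictScalars ℂ t ∈ H0 a b := by
  intro t ht P _
  have ht' := (Submodule.mem_iInf _).1 ht P
  suffices h : ∀ u ∈ Submodule.span ℂ {t | ∃ V : Set Pt, IsZariskiOpen V ∧ P ∈ V ∧
      ∃ D ∈ sigmaSec d e V, ∃ r ∈ sec (a - d) (b - e) V, t = D ⊗ₜ[funField] r},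
      (ratDiff a b σ.1).restrictScalars ℂ u ∈ sec a b {P} from h t ht' P rfl
  intro u hu
  refine Submodule.span_le.2 ?_ hu |> Submodule.mem_comap.1
  rintro _ ⟨V, hV, hP, D, hD, r, hr, rfl⟩
  rintro Q rfl
  exact IsQuot.mul (nonzeroAt_mul _) (add_sub_cancel d a) (add_sub_cancel e b)
    (hD V hV subset_rfl σ.1 (fun Q _ => σ.2 Q trivial) _ hP) (hr _ hP)

/-- The map `dσ : H⁰(Σ_L ⊗ M ⊗ L^∨) → H⁰(M)`, for a global section `σ` of `L = 𝒪(d, e)` and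
`M = 𝒪(a, b)`. -/
def diff {d e : ℤ} (a b : ℤ) (σ : H0 d e) : H0Sigma d e (a - d) (b - e) →ₗ[ℂ] H0 a b :=
  ((ratDiff a b σ.1).restrictScalars ℂ).restrict (ratDiff_mem a b σ)

/-- The generalized Jacobian ideal `J_{a,b} = J_M ⊆ H⁰(M)` with respect to the global section `σ` of
`L`, for `M = 𝒪(a, b)`. -/
def genJacobian {d e : ℤ} (a b : ℤ) (σ : H0 d e) : Submodule ℂ (H0 a b) :=
  LinearMap.range (diff a b σ)

/-- The partial derivative `∂F/∂x_i`. -/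
def dx (i : Fin 2) (F : S) : S := MvPolynomial.pderiv (Sum.inl i) F

/-- The partial derivative `∂F/∂y_j`. -/
def dy (j : Fin 2) (F : S) : S := MvPolynomial.pderiv (Sum.inr j) F

/-- The usual Jacobian ideal, generated by the four partial derivatives of `F`. -/
def jacobianIdeal (F : S) : Ideal S := Ideal.span {dx 0 F, dx 1 F, dy 0 F, dy 1 F}

/-- The summand `I_{a,b} = I ∩ S_{a,b}` of an ideal `I`, as a subspace of `S_{a,b}`. -/
def idealPart (I : Ideal S) (a b : ℤ) : Submodule ℂ (bihom a b) :=
  (I.restrictScalars ℂ).comap (bihom a b).subtype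

end P1P1

end

/-!
The rational sections of `L = 𝒪(d, e)` and `M = 𝒪(a, b)` live in the field of fractions `K` of `S`,
and a global section of `Σ_L ⊗ L^∨ ⊗ M` is a first-order operator `T` from `L` to `M` that preserves
regularity at every point (`isRegularOp_opOfTensor`). Put `(m, n) = (a - d, b - e)`.

For `P` of bidegree `(m + 1, n)` the operator `P ∂/∂x_i` is such a section: near a point with
`x_k ≠ 0` it is `x_k ∂/∂x_i ⊗ P / x_k`. So every bihomogeneous combination of the partial derivatives
of `F` is a value of `dF` (`map_idealPart_le_genJacobian`).

Conversely, let `T` be given, with symbol `X`, a derivation of the function field with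
`T (g f) = g T f + X(g) f`. Let `R` be the factor by which `T` acts on `x₀ ^ d * y₀ ^ e`, and `ξ`, `η`
the logarithmic derivatives of `x₁ / x₀` and `y₁ / y₀` under `X`. Then
`T F = R F + ξ x₁ ∂F/∂x₁ + η y₁ ∂F/∂y₁` (`op_monomial`, `op_eq_of_monomial`). A section that is
regular everywhere is a polynomial (`exists_poly_of_regular`), hence so are `A = ξ x₀ x₁` and
`B = η y₀ y₁`, of bidegrees `(m + 2, n)` and `(m, n + 2)`. On the four standard charts, `R` is
replaced by `R`, `R + d ξ`, `R + e η` and `R + d ξ + e η`.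

If `m, n ≥ -1`, then `A = x₀ P₁ - x₁ P₀` and `B = y₀ Q₁ - y₁ Q₀` with polynomial coefficients, and
`c = R - d P₀ / x₀ - e Q₀ / y₀` is regular on every chart, hence a polynomial. Euler's identities
give `T F = c F + ∑ P_i ∂F/∂x_i + ∑ Q_j ∂F/∂y_j`, and `F` itself lies in its Jacobian ideal by
Euler's identities, since `(d, e) ≠ (0, 0)`. If `n ≤ -2`, then `A = 0`, and comparing the charts
`y₀ ≠ 0` and `y₁ ≠ 0` gives `R = 0` and `e η = 0` (`eq_zero_of_regular`), so that `T F = 0`; the case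
`m ≤ -2` is symmetric. This is `mem_jacobianIdeal_of_local_data`.
-/

noncomputable section

namespace P1P1

open scoped TensorProduct
open MvPolynomial

/-! ### Bihomogeneous polynomials -/

theorem mem_bihom_iff {m n : ℤ} {p : S} :
    p ∈ bihom m n ↔ IsWeightedHomogeneous bidegree p (m, n) :=
  mem_weightedHomogeneousSubmodule ..

theorem weight_bidegree (α : Fin 2 ⊕ Fin 2 →₀ ℕ) :
    Finsupp.weight bidegree α = ((α (.inl 0) + α (.inl 1) : ℤ), (α (.inr 0) + α (.inr 1) : ℤ)) := by
  rw [Finsupp.weight_apply, Finsupp.sum_fintype _ _ (by simp)]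
  simp [bidegree, Prod.ext_iff]

theorem X_mem_bihom (w : Fin 2 ⊕ Fin 2) : (X w : S) ∈ bihom (bidegree w).1 (bidegree w).2 :=
  mem_bihom_iff.2 (isWeightedHomogeneous_X ℂ bidegree w)

theorem x_mem_bihom (i : Fin 2) : (X (.inl i) : S) ∈ bihom 1 0 := X_mem_bihom _

theorem y_mem_bihom (j : Fin 2) : (X (.inr j) : S) ∈ bihom 0 1 := X_mem_bihom _

theorem pderiv_mem_bihom {m n m' n' : ℤ} {p : S} (hp : p ∈ bihom m n) (w : Fin 2 ⊕ Fin 2)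
    (hm : m' + (bidegree w).1 = m) (hn : n' + (bidegree w).2 = n) : pderiv w p ∈ bihom m' n' :=
  mem_bihom_iff.2 ((mem_bihom_iff.1 hp).pderiv (Prod.ext hm hn))

theorem dx_mem_bihom {m n : ℤ} {p : S} (hp : p ∈ bihom m n) (i : Fin 2) :
    dx i p ∈ bihom (m - 1) n :=
  pderiv_mem_bihom hp _ (sub_add_cancel m 1) (add_zero n)

theorem dy_mem_bihom {m n : ℤ} {p : S} (hp : p ∈ bihom m n) (j : Fin 2) :
    dy j p ∈ bihom m (n - 1) :=
  pderiv_mem_bihom hp _ (add_zero m) (sub_add_cancel n 1)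

theorem nonneg_of_mem_bihom {m n : ℤ} {p : S} (hp : p ∈ bihom m n) (h0 : p ≠ 0) :
    0 ≤ m ∧ 0 ≤ n := by
  obtain ⟨α, hα⟩ := MvPolynomial.ne_zero_iff.1 h0
  have h := mem_bihom_iff.1 hp hα
  rw [weight_bidegree, Prod.mk.injEq] at h
  omega

theorem eq_zero_of_mem_bihom {m n : ℤ} {p : S} (hp : p ∈ bihom m n) (h : m < 0 ∨ n < 0) :
    p = 0 := by
  by_contra h0
  have := nonneg_of_mem_bihom hp h0
  omega

/-- A linear map on `S_{m,n}` is determined by its values on monomials. -/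
theorem bihom_linear_ext {V : Type*} [AddCommGroup V] [Module ℂ V] {m n : ℤ}
    {f g : bihom m n →ₗ[ℂ] V}
    (h : ∀ (α : Fin 2 ⊕ Fin 2 →₀ ℕ) (hα : monomial α 1 ∈ bihom m n), f ⟨_, hα⟩ = g ⟨_, hα⟩) :
    f = g := by
  suffices H : ∀ (p : S) (hp : IsWeightedHomogeneous bidegree p (m, n)),
      f ⟨p, mem_bihom_iff.2 hp⟩ = g ⟨p, mem_bihom_iff.2 hp⟩ from
    LinearMap.ext fun p => H p (mem_bihom_iff.1 p.2)
  intro p hp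
  induction hp using IsWeightedHomogeneous.induction_on with
  | zero => exact (map_zero f).trans (map_zero g).symm
  | add p q hp hq ihp ihq =>
    have := congrArg₂ (· + ·) ihp ihq
    rwa [← map_add, ← map_add] at this
  | monomial α r hr =>
    have hα : monomial α 1 ∈ bihom m n :=
      mem_bihom_iff.2 (isWeightedHomogeneous_monomial _ _ _ hr)
    have hr' : monomial α r ∈ bihom m n :=
      mem_bihom_iff.2 (isWeightedHomogeneous_monomial _ _ _ hr)
    have e : (⟨monomial α r, hr'⟩ : bihom m n) = r • ⟨monomial α 1, hα⟩ := by
      apply Subtype.ext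
      simp [smul_monomial]
    rw [e, map_smul, map_smul, h]

/-- Euler's identity in the variables `x₀, x₁`. -/
theorem euler_x {m n : ℤ} {p : S} (hp : p ∈ bihom m n) :
    X (.inl 0) * dx 0 p + X (.inl 1) * dx 1 p = C (m : ℂ) * p := by
  have hp' := mem_bihom_iff.1 hp
  clear hp
  unfold dx
  induction hp' using IsWeightedHomogeneous.induction_on with
  | zero => simp
  | add p q hp hq ihp ihq =>
    rw [map_add, map_add]
    linear_combination ihp + ihq
  | monomial α r hr =>
    rw [weight_bidegree, Prod.mk.injEq] at hr
    rw [X_mul_pderiv_monomial, X_mul_pderiv_monomial, ← add_smul, nsmul_eq_mul, ← hr.1]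
    simp

/-- Euler's identity in the variables `y₀, y₁`. -/
theorem euler_y {m n : ℤ} {p : S} (hp : p ∈ bihom m n) :
    X (.inr 0) * dy 0 p + X (.inr 1) * dy 1 p = C (n : ℂ) * p := by
  have hp' := mem_bihom_iff.1 hp
  clear hp
  unfold dy
  induction hp' using IsWeightedHomogeneous.induction_on with
  | zero => simp
  | add p q hp hq ihp ihq =>
    rw [map_add, map_add]
    linear_combination ihp + ihq
  | monomial α r hr =>
    rw [weight_bidegree, Prod.mk.injEq] at hr
    rw [X_mul_pderiv_monomial, X_mul_pderiv_monomial, ← add_smul, nsmul_eq_mul, ← hr.2]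
    simp

/-- A form of positive degree in `x₀, x₁` lies in the ideal `(x₀, x₁)`. By Euler's identity its
partial derivatives serve as coefficients. -/
theorem exists_eq_x_mul_sub {m n : ℤ} (hm : 0 < m) {p : S} (hp : p ∈ bihom m n) :
    ∃ P₀ ∈ bihom (m - 1) n, ∃ P₁ ∈ bihom (m - 1) n, p = X (.inl 0) * P₁ - X (.inl 1) * P₀ := by
  have hm' : (m : ℂ) ≠ 0 := by exact_mod_cast hm.ne'
  refine ⟨-((m : ℂ)⁻¹ • dx 1 p), Submodule.neg_mem _ (Submodule.smul_mem _ _ (dx_mem_bihom hp 1)),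
    (m : ℂ)⁻¹ • dx 0 p, Submodule.smul_mem _ _ (dx_mem_bihom hp 0), ?_⟩
  rw [mul_neg, sub_neg_eq_add, mul_smul_comm, mul_smul_comm, ← smul_add, euler_x hp,
    ← smul_eq_C_mul, smul_smul, inv_mul_cancel₀ hm', one_smul]

/-- A form of positive degree in `y₀, y₁` lies in the ideal `(y₀, y₁)`. -/
theorem exists_eq_y_mul_sub {m n : ℤ} (hn : 0 < n) {p : S} (hp : p ∈ bihom m n) :
    ∃ Q₀ ∈ bihom m (n - 1), ∃ Q₁ ∈ bihom m (n - 1), p = X (.inr 0) * Q₁ - X (.inr 1) * Q₀ := by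
  have hn' : (n : ℂ) ≠ 0 := by exact_mod_cast hn.ne'
  refine ⟨-((n : ℂ)⁻¹ • dy 1 p), Submodule.neg_mem _ (Submodule.smul_mem _ _ (dy_mem_bihom hp 1)),
    (n : ℂ)⁻¹ • dy 0 p, Submodule.smul_mem _ _ (dy_mem_bihom hp 0), ?_⟩
  rw [mul_neg, sub_neg_eq_add, mul_smul_comm, mul_smul_comm, ← smul_add, euler_y hp,
    ← smul_eq_C_mul, smul_smul, inv_mul_cancel₀ hn', one_smul]

theorem component_mul {k l i j : ℤ} (p : S) {q : S} (hq : q ∈ bihom i j) :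
    weightedHomogeneousComponent bidegree (k + i, l + j) (p * q) =
      weightedHomogeneousComponent bidegree (k, l) p * q := by
  let _ := weightedGradedAlgebra ℂ bidegree
  have h := DirectSum.coe_decompose_mul_add_of_right_mem
    (weightedHomogeneousSubmodule ℂ bidegree) (a := p) (i := (k, l)) (j := (i, j)) hq
  have e (r : S) (s : ℤ × ℤ) : ((DirectSum.decompose (weightedHomogeneousSubmodule ℂ bidegree) r s :
      weightedHomogeneousSubmodule ℂ bidegree s) : S) = weightedHomogeneousComponent bidegree s r :=
    weightedDecomposition.decompose'_apply ℂ bidegree r s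
  rw [e, e] at h
  exact h

theorem component_mem_bihom (k l : ℤ) (p : S) :
    weightedHomogeneousComponent bidegree (k, l) p ∈ bihom k l :=
  weightedHomogeneousComponent_mem ..

theorem component_of_mem {k l : ℤ} {p : S} (hp : p ∈ bihom k l) :
    weightedHomogeneousComponent bidegree (k, l) p = p :=
  (mem_bihom_iff.1 hp).weightedHomogeneousComponent_same

/-- A polynomial that becomes bihomogeneous after multiplication by a nonzero bihomogeneous
polynomial is bihomogeneous. -/
theorem mem_bihom_of_mul_mem {i j m n : ℤ} {p q : S} (hq : q ∈ bihom i j) (hq0 : q ≠ 0)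
    (h : p * q ∈ bihom (i + m) (j + n)) : p ∈ bihom m n := by
  rw [add_comm i, add_comm j] at h
  have h1 := component_mul (k := m) (l := n) p hq
  rw [component_of_mem h] at h1
  rw [mul_right_cancel₀ hq0 h1]
  exact component_mem_bihom m n p

/-- The summand of the Jacobian ideal consists of the combinations of the partial derivatives with
bihomogeneous coefficients. -/
theorem mem_jacobianIdeal_iff {d e : ℤ} {F : S} (hF : F ∈ bihom d e) {a b : ℤ} {G : S}
    (hG : G ∈ bihom a b) : G ∈ jacobianIdeal F ↔
      ∃ P₀ ∈ bihom (a - d + 1) (b - e), ∃ P₁ ∈ bihom (a - d + 1) (b - e),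
      ∃ Q₀ ∈ bihom (a - d) (b - e + 1), ∃ Q₁ ∈ bihom (a - d) (b - e + 1),
        G = P₀ * dx 0 F + P₁ * dx 1 F + Q₀ * dy 0 F + Q₁ * dy 1 F := by
  constructor
  · intro h
    simp only [jacobianIdeal, Ideal.mem_span_insert, Ideal.mem_span_singleton'] at h
    obtain ⟨P₀, _, ⟨P₁, _, ⟨Q₀, _, ⟨Q₁, rfl⟩, rfl⟩, rfl⟩, rfl⟩ := h
    refine ⟨_, component_mem_bihom _ _ P₀, _, component_mem_bihom _ _ P₁,
      _, component_mem_bihom _ _ Q₀, _, component_mem_bihom _ _ Q₁, ?_⟩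
    simp only [← component_mul _ (dx_mem_bihom hF _), ← component_mul _ (dy_mem_bihom hF _)]
    simp only [sub_add_cancel,
      show a - d + 1 + (d - 1) = a by ring, show b - e + 1 + (e - 1) = b by ring, ← map_add]
    rw [component_of_mem]
    · ring
    · convert hG using 1
      ring
  · rintro ⟨P₀, -, P₁, -, Q₀, -, Q₁, -, rfl⟩
    have hs (p : S) (h : p ∈ ({dx 0 F, dx 1 F, dy 0 F, dy 1 F} : Set S)) : p ∈ jacobianIdeal F :=
      Ideal.subset_span h
    refine add_mem (add_mem (add_mem ?_ ?_) ?_) ?_ <;>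
      exact Ideal.mul_mem_left _ _ (hs _ (by simp))

/-- By Euler's identities a form that is not constant lies in its own Jacobian ideal. -/
theorem self_mem_jacobianIdeal {d e : ℤ} {F : S} (hF : F ∈ bihom d e) (hirr : Irreducible F) :
    F ∈ jacobianIdeal F := by
  have hs (p : S) (h : p ∈ ({dx 0 F, dx 1 F, dy 0 F, dy 1 F} : Set S)) : p ∈ jacobianIdeal F :=
    Ideal.subset_span h
  have key (c : ℂ) (hc : c ≠ 0) (h : C c * F ∈ jacobianIdeal F) : F ∈ jacobianIdeal F := by
    have := Ideal.mul_mem_left _ (C c⁻¹) h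
    rwa [← mul_assoc, ← C_mul, inv_mul_cancel₀ hc, C_1, one_mul] at this
  by_cases hd : d = 0
  · by_cases he : e = 0
    · subst hd he
      exfalso
      refine hirr.not_isUnit ?_
      have hc : F = C (coeff 0 F) := by
        ext α
        rw [coeff_C]
        split_ifs with h
        · rw [h]
        · refine (mem_bihom_iff.1 hF).coeff_eq_zero α fun h' => h ?_
          rw [weight_bidegree, Prod.mk.injEq] at h'
          ext (i | i) <;> fin_cases i <;> simp <;> omega
      rw [hc]
      refine (IsUnit.mk0 _ fun h0 => hirr.ne_zero ?_).map C
      rw [hc, h0, C_0]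
    · refine key e (by exact_mod_cast he) ?_
      rw [← euler_y hF]
      refine add_mem ?_ ?_ <;> exact Ideal.mul_mem_left _ _ (hs _ (by simp))
  · refine key d (by exact_mod_cast hd) ?_
    rw [← euler_x hF]
    refine add_mem ?_ ?_ <;> exact Ideal.mul_mem_left _ _ (hs _ (by simp))

/-! ### Global sections of `𝒪(m, n)` -/

theorem eval_smul_of_mem_bihom {i j : ℤ} {q : S} (hq : q ∈ bihom i j) (s t : ℂ)
    (v w : Fin 2 → ℂ) : eval (Sum.elim (s • v) (t • w)) q =
      s ^ i.toNat * t ^ j.toNat * eval (Sum.elim v w) q := by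
  have hq' := mem_bihom_iff.1 hq
  clear hq
  induction hq' using IsWeightedHomogeneous.induction_on with
  | zero => simp
  | add p q hp hq ihp ihq => rw [map_add, map_add, ihp, ihq, mul_add]
  | monomial α r hr =>
    rw [weight_bidegree, Prod.mk.injEq] at hr
    have h1 : i.toNat = α (.inl 0) + α (.inl 1) := by omega
    have h2 : j.toNat = α (.inr 0) + α (.inr 1) := by omega
    rw [h1, h2, eval_monomial, eval_monomial, Finsupp.prod_fintype _ _ (by simp),
      Finsupp.prod_fintype _ _ (by simp)]
    simp only [Fintype.prod_sum_type, Fin.prod_univ_two, Sum.elim_inl, Sum.elim_inr, Pi.smul_apply,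
      smul_eq_mul]
    ring

theorem eval_ne_zero_of_valAt_ne_zero {i j : ℤ} {q : S} (hq : q ∈ bihom i j) {v w : Fin 2 → ℂ}
    (hv : v ≠ 0) (hw : w ≠ 0)
    (h : valAt (Projectivization.mk ℂ v hv, Projectivization.mk ℂ w hw) q ≠ 0) :
    eval (Sum.elim v w) q ≠ 0 := by
  obtain ⟨s, hs⟩ := Projectivization.exists_smul_eq_mk_rep ℂ v hv
  obtain ⟨t, ht⟩ := Projectivization.exists_smul_eq_mk_rep ℂ w hw
  intro h0
  apply h
  unfold valAt
  rw [← hs, ← ht]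
  exact (eval_smul_of_mem_bihom hq s t v w).trans (by rw [h0, mul_zero])

theorem algebraMap_injective : Function.Injective (algebraMap S K) :=
  IsFractionRing.injective S K

/-- A polynomial without zeros outside `{x = 0} ∪ {y = 0}` is a unit: by the Nullstellensatz it
divides powers of `x₀ y₀` and of `x₁ y₁`. -/
theorem isUnit_of_eval_ne_zero {q : S}
    (h : ∀ v w : Fin 2 → ℂ, v ≠ 0 → w ≠ 0 → eval (Sum.elim v w) q ≠ 0) : IsUnit q := by
  have key (i : Fin 2) : ∃ N : ℕ, q ∣ (X (.inl i) * X (.inr i) : S) ^ N := by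
    have hrad : (X (.inl i) * X (.inr i) : S) ∈ (Ideal.span {q}).radical := by
      rw [← vanishingIdeal_zeroLocus_eq_radical (K := ℂ)]
      intro z hz
      rw [zeroLocus_span] at hz
      have hz' : eval (Sum.elim (z ∘ Sum.inl) (z ∘ Sum.inr)) q = 0 := by
        rw [Sum.elim_comp_inl_inr]
        simpa [aeval_eq_eval] using hz q rfl
      have h0 : z ∘ Sum.inl = 0 ∨ z ∘ Sum.inr = 0 := by
        by_contra! hne
        exact h _ _ hne.1 hne.2 hz'
      rcases h0 with h0 | h0
      · simp [show z (.inl i) = 0 from congrFun h0 i]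
      · simp [show z (.inr i) = 0 from congrFun h0 i]
    obtain ⟨N, hN⟩ := hrad
    exact ⟨N, Ideal.mem_span_singleton.1 hN⟩
  obtain ⟨N, hN⟩ := key 0
  obtain ⟨N', hN'⟩ := key 1
  have hrel : IsRelPrime ((X (.inl 0) * X (.inr 0) : S) ^ N) ((X (.inl 1) * X (.inr 1)) ^ N') := by
    have hX (w w' : Fin 2 ⊕ Fin 2) (hne : w ≠ w') : IsRelPrime (X w : S) (X w') := by
      refine (X_prime (R := ℂ) (i := w)).irreducible.isRelPrime_iff_not_dvd.2 fun hd => ?_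
      obtain ⟨c, hc⟩ := hd
      have := congrArg (eval (Function.update (1 : Fin 2 ⊕ Fin 2 → ℂ) w 0)) hc
      simp [Function.update_of_ne hne.symm] at this
    refine IsRelPrime.pow (IsRelPrime.mul_left ?_ ?_)
    · exact IsRelPrime.mul_right (hX _ _ (by simp)) (hX _ _ (by simp))
    · exact IsRelPrime.mul_right (hX _ _ (by simp)) (hX _ _ (by simp))
  exact hrel hN hN'

/-- A rational section of `𝒪(m, n)` that is regular at every point is a bihomogeneous polynomial. In
lowest terms its denominator divides, for every point, an admissible denominator that does not
vanish at this point. -/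
theorem exists_poly_of_regular {m n : ℤ} {r : K} (h : ∀ P, IsQuot (nonzeroAt P) m n r) :
    ∃ p ∈ bihom m n, r = algebraMap S K p := by
  obtain ⟨p, ⟨q, hq⟩, hrel, hr⟩ := IsFractionRing.exists_reduced_fraction S r
  have hq0 : q ≠ 0 := nonZeroDivisors.ne_zero hq
  have hqK : algebraMap S K q ≠ 0 := by simpa using hq0
  rw [IsFractionRing.mk'_eq_div] at hr
  have hunit : IsUnit q := by
    refine isUnit_of_eval_ne_zero fun v w hv hw h0 => ?_
    obtain ⟨i, j, p', q', hp', hq', hq'0, hg, hr'⟩ :=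
      h (Projectivization.mk ℂ v hv, Projectivization.mk ℂ w hw)
    have hq'K : algebraMap S K q' ≠ 0 := by simpa using hq'0
    have hcross : p * q' = p' * q := by
      apply algebraMap_injective
      rw [map_mul, map_mul]
      rw [hr', div_eq_div_iff hqK hq'K] at hr
      exact hr
    have hdvd : q ∣ q' := hrel.symm.dvd_of_dvd_mul_left ⟨p', by rw [hcross, mul_comm]⟩
    obtain ⟨c, hc⟩ := hdvd
    refine eval_ne_zero_of_valAt_ne_zero hq' hv hw hg ?_
    rw [hc, map_mul, h0, zero_mul]
  obtain ⟨u, rfl⟩ := hunit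
  have hr2 : r = algebraMap S K (p * ↑u⁻¹) := by
    rw [← hr, div_eq_iff hqK, ← map_mul, mul_assoc, Units.inv_mul, mul_one]
  refine ⟨_, ?_, hr2⟩
  obtain ⟨i, j, p', q', hp', hq', hq'0, -, hr'⟩ := h (Projectivization.mk ℂ 1 one_ne_zero,
    Projectivization.mk ℂ 1 one_ne_zero)
  refine mem_bihom_of_mul_mem hq' hq'0 (?_ : _ ∈ bihom (i + m) (j + n))
  have hq'K : algebraMap S K q' ≠ 0 := by simpa using hq'0
  rw [hr2, eq_div_iff hq'K, ← map_mul] at hr'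
  rwa [algebraMap_injective hr']

/-- At every point some coordinate of the first factor does not vanish. -/
theorem exists_x_ne_zero (P : Pt) : ∃ i : Fin 2, valAt P (X (.inl i)) ≠ 0 := by
  obtain ⟨i, hi⟩ := Function.ne_iff.1 P.1.rep_nonzero
  exact ⟨i, by simpa [valAt] using hi⟩

/-- At every point some coordinate of the second factor does not vanish. -/
theorem exists_y_ne_zero (P : Pt) : ∃ j : Fin 2, valAt P (X (.inr j)) ≠ 0 := by
  obtain ⟨i, hi⟩ := Function.ne_iff.1 P.2.rep_nonzero
  exact ⟨i, by simpa [valAt] using hi⟩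

theorem IsQuot.neg {good : S → Prop} {m n : ℤ} {r : K} (hr : IsQuot good m n r) :
    IsQuot good m n (-r) := by
  obtain ⟨i, j, p, q, hp, hq, hq0, hg, rfl⟩ := hr
  exact ⟨i, j, -p, q, neg_mem hp, hq, hq0, hg, by rw [map_neg, neg_div]⟩

theorem IsQuot.sub {good : S → Prop} (hm : ∀ p q, good p → good q → good (p * q)) {m n : ℤ}
    {r s : K} (hr : IsQuot good m n r) (hs : IsQuot good m n s) : IsQuot good m n (r - s) := by
  rw [sub_eq_add_neg]
  exact hr.add hm hs.neg

theorem IsQuot.of_inv {good : S → Prop} {m n : ℤ} {q : S} (hq : q ∈ bihom m n) (hq0 : q ≠ 0)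
    (hg : good q) : IsQuot good (-m) (-n) (algebraMap S K q)⁻¹ :=
  ⟨m, n, 1, q, by simpa using one_mem_bihom, hq, hq0, hg, by rw [map_one, one_div]⟩

theorem IsQuot.div {good : S → Prop} (hm : ∀ p q, good p → good q → good (p * q))
    {m n i j m' n' : ℤ} {r : K} (hr : IsQuot good m n r) {q : S} (hq : q ∈ bihom i j) (hq0 : q ≠ 0)
    (hg : good q) (h1 : m = m' + i) (h2 : n = n' + j) :
    IsQuot good m' n' (r / algebraMap S K q) := by
  rw [div_eq_mul_inv]
  exact IsQuot.mul hm (by omega) (by omega) hr (IsQuot.of_inv hq hq0 hg)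

/-! ### Partial derivatives of rational functions -/

/-- The ring homomorphism `p ↦ p + ε ∂p` to the dual numbers over the field of fractions. -/
def dualHom (w : Fin 2 ⊕ Fin 2) : S →+* DualNumber K where
  toFun p := TrivSqZeroExt.inl (algebraMap S K p) + TrivSqZeroExt.inr (algebraMap S K (pderiv w p))
  map_one' := by simp
  map_mul' p q := by
    ext
    · simp
    · simp [-DualNumber.inr_eq_smul_eps]
      ring
  map_zero' := by simp
  map_add' p q := by
    ext <;> simp [-DualNumber.inr_eq_smul_eps]

/-- The extension of `p ↦ p + ε ∂p` to the field of fractions. -/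
def dualHomK (w : Fin 2 ⊕ Fin 2) : K →+* DualNumber K :=
  IsLocalization.lift (M := nonZeroDivisors S) (g := dualHom w) fun q => by
    rw [TrivSqZeroExt.isUnit_iff_isUnit_fst]
    simp [dualHom, nonZeroDivisors.ne_zero q.2]

theorem dualHomK_algebraMap (w : Fin 2 ⊕ Fin 2) (p : S) :
    dualHomK w (algebraMap S K p) = dualHom w p :=
  IsLocalization.lift_eq _ p

theorem fst_dualHomK (w : Fin 2 ⊕ Fin 2) (r : K) : (dualHomK w r).fst = r := by
  have : (TrivSqZeroExt.fstHom K K K).toRingHom.comp (dualHomK w) = RingHom.id K := by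
    refine IsLocalization.ringHom_ext (nonZeroDivisors S) (RingHom.ext fun p => ?_)
    change (dualHomK w (algebraMap S K p)).fst = algebraMap S K p
    rw [dualHomK_algebraMap]
    simp [dualHom]
  exact RingHom.congr_fun this r

theorem snd_dualHomK_mul (w : Fin 2 ⊕ Fin 2) (r s : K) : (dualHomK w (r * s)).snd =
    r * (dualHomK w s).snd + s * (dualHomK w r).snd := by
  rw [map_mul, TrivSqZeroExt.snd_mul, fst_dualHomK, fst_dualHomK]
  simp [mul_comm]

/-- The partial derivative with respect to the variable `w`, on the field of fractions of `S`. -/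
def pderivK (w : Fin 2 ⊕ Fin 2) : Derivation ℂ K K :=
  Derivation.mk'
    { toFun := fun r => (dualHomK w r).snd
      map_add' := fun r s => by rw [map_add, TrivSqZeroExt.snd_add]
      map_smul' := fun c r => by
        rw [Algebra.smul_def, snd_dualHomK_mul, ← algebraMap_const, dualHomK_algebraMap]
        simp [dualHom, Algebra.smul_def, algebraMap_const] }
    fun r s => snd_dualHomK_mul w r s

theorem pderivK_algebraMap (w : Fin 2 ⊕ Fin 2) (p : S) :
    pderivK w (algebraMap S K p) = algebraMap S K (pderiv w p) := by
  change (dualHomK w (algebraMap S K p)).snd = _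
  rw [dualHomK_algebraMap]
  simp [dualHom, -DualNumber.inr_eq_smul_eps]

theorem IsQuot.pderivK {good : S → Prop} (hm : ∀ p q, good p → good q → good (p * q)) {m n : ℤ}
    {r : K} (hr : IsQuot good m n r) (w : Fin 2 ⊕ Fin 2) :
    IsQuot good (m - (bidegree w).1) (n - (bidegree w).2) (pderivK w r) := by
  obtain ⟨i, j, p, q, hp, hq, hq0, hg, rfl⟩ := hr
  have hqK : algebraMap S K q ≠ 0 := by simpa using hq0
  refine ⟨i + i, j + j, q * pderiv w p - p * pderiv w q, q * q, ?_, bihom_mul hq hq,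
    mul_ne_zero hq0 hq0, hm _ _ hg hg, ?_⟩
  · have h1 := bihom_mul hq (pderiv_mem_bihom hp w (sub_add_cancel _ _) (sub_add_cancel _ _))
    have h2 := bihom_mul hp (pderiv_mem_bihom hq w (sub_add_cancel _ _) (sub_add_cancel _ _))
    refine sub_mem ?_ ?_
    · convert h1 using 1
      ring_nf
    · convert h2 using 1
      ring_nf
  · rw [Derivation.leibniz_div, pderivK_algebraMap, pderivK_algebraMap]
    simp only [map_sub, map_mul, smul_eq_mul]
    field_simp

/-- The operator `X_v ∂/∂X_w` on `𝒪(d, e)`, for variables `v` and `w` of the same bidegree. -/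
def eulerOp (d e : ℤ) {v w : Fin 2 ⊕ Fin 2} (h : bidegree v = bidegree w) : ratSigma d e where
  val :=
    { toFun := fun f => ⟨algebraMap S K (X v) * pderivK w f,
        IsQuot.mul anyDen_mul (by rw [h]; ring) (by rw [h]; ring)
          (IsQuot.of_poly anyDen_one (X_mem_bihom v)) (f.2.pderivK anyDen_mul w)⟩
      map_add' := fun f g => Subtype.ext <| by
        change _ * pderivK w (f + g) = _ * pderivK w f + _ * pderivK w g
        rw [map_add, mul_add]
      map_smul' := fun c f => Subtype.ext <| by
        change _ * pderivK w (c • (f : K)) = c • (_ * pderivK w f)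
        rw [Derivation.map_smul, mul_smul_comm] }
  property := fun g h f => Subtype.ext <| by
    change _ * pderivK w ((g : K) * ((h : K) * (f : K)))
      - (g : K) * (_ * pderivK w ((h : K) * f)) - (h : K) * (_ * pderivK w ((g : K) * f))
      + (g : K) * ((h : K) * (_ * pderivK w f)) = 0
    simp only [Derivation.leibniz, smul_eq_mul]
    ring

theorem eulerOp_mem_sigmaSec {d e : ℤ} {v w : Fin 2 ⊕ Fin 2} (h : bidegree v = bidegree w)
    (U : Set Pt) : eulerOp d e h ∈ sigmaSec d e U := by
  intro V _ _ f hf P hP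
  have := IsQuot.mul (nonzeroAt_mul P) (m'' := d) (n'' := e) (by rw [h]; ring) (by rw [h]; ring)
    (IsQuot.of_poly (nonzeroAt_one P) (X_mem_bihom v)) ((hf P hP).pderivK (nonzeroAt_mul P) w)
  exact this

/-! ### The Jacobian ideal consists of values of the differential -/

theorem isZariskiOpen_inter_ne_zero {V : Set Pt} (hV : IsZariskiOpen V) {i j : ℤ} {q : S}
    (hq : q ∈ bihom i j) : IsZariskiOpen (V ∩ {P | valAt P q ≠ 0}) := by
  obtain ⟨T, hT, rfl⟩ := hV
  refine ⟨(· * q) '' T, ?_, ?_⟩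
  · rintro _ ⟨h, hh, rfl⟩
    obtain ⟨i', j', h'⟩ := hT h hh
    exact ⟨_, _, bihom_mul h' hq⟩
  · ext P
    simp only [Set.mem_inter_iff, Set.mem_ofPred_eq, Set.exists_mem_image, map_mul, mul_ne_zero_iff]
    constructor
    · rintro ⟨⟨h, hh, h1⟩, h2⟩
      exact ⟨h, hh, h1, h2⟩
    · rintro ⟨h, hh, h1, h2⟩
      exact ⟨⟨h, hh, h1⟩, h2⟩

theorem isZariskiOpen_ne_zero {i j : ℤ} {q : S} (hq : q ∈ bihom i j) :
    IsZariskiOpen {P | valAt P q ≠ 0} :=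
  ⟨{q}, by rintro _ rfl; exact ⟨i, j, hq⟩, by ext; simp⟩

/-- At every point some variable of a given bidegree does not vanish. -/
theorem exists_valAt_X_ne_zero (w : Fin 2 ⊕ Fin 2) (P : Pt) :
    ∃ v, bidegree v = bidegree w ∧ valAt P (X v) ≠ 0 := by
  rcases w with i | j
  · obtain ⟨i', h⟩ := exists_x_ne_zero P
    exact ⟨.inl i', rfl, h⟩
  · obtain ⟨j', h⟩ := exists_y_ne_zero P
    exact ⟨.inr j', rfl, h⟩

theorem algebraMap_X_ne_zero (v : Fin 2 ⊕ Fin 2) : algebraMap S K (X v) ≠ 0 := by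
  simp [X_ne_zero]

/-- The rational section `p / X_v`. -/
def divX {m n m' n' : ℤ} (v : Fin 2 ⊕ Fin 2) (h1 : m' = m + (bidegree v).1)
    (h2 : n' = n + (bidegree v).2) (p : bihom m' n') : ratSec m n :=
  ⟨algebraMap S K p / algebraMap S K (X v),
    IsQuot.div anyDen_mul (IsQuot.of_poly anyDen_one p.2) (X_mem_bihom v) (X_ne_zero v) trivial
      h1 h2⟩

theorem divX_mem_sec {m n m' n' : ℤ} (v : Fin 2 ⊕ Fin 2) (h1 : m' = m + (bidegree v).1)
    (h2 : n' = n + (bidegree v).2) (p : bihom m' n') :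
    divX v h1 h2 p ∈ sec m n {P | valAt P (X v) ≠ 0} := fun P hP =>
  IsQuot.div (nonzeroAt_mul P) (IsQuot.of_poly (nonzeroAt_one P) p.2) (X_mem_bihom v)
    (X_ne_zero v) hP h1 h2

/-- The tensor `X_v ∂/∂X_w ⊗ p / X_v` does not depend on `v`. -/
theorem eulerOp_tmul_divX {d e m n m' n' : ℤ} {v v' w : Fin 2 ⊕ Fin 2}
    (h : bidegree v = bidegree w) (h' : bidegree v' = bidegree w)
    (h1 : m' = m + (bidegree v).1) (h2 : n' = n + (bidegree v).2)
    (h1' : m' = m + (bidegree v').1) (h2' : n' = n + (bidegree v').2) (p : bihom m' n') :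
    eulerOp d e h ⊗ₜ[funField] divX v h1 h2 p =
      eulerOp d e h' ⊗ₜ[funField] divX v' h1' h2' p := by
  let g : funField := ⟨algebraMap S K (X v) / algebraMap S K (X v'),
    IsQuot.div anyDen_mul (IsQuot.of_poly anyDen_one (X_mem_bihom v)) (X_mem_bihom v')
      (X_ne_zero v') trivial (by rw [h, h', zero_add]) (by rw [h, h', zero_add])⟩
  have hv := algebraMap_X_ne_zero v
  have hv' := algebraMap_X_ne_zero v'
  have e1 : eulerOp d e h = g • eulerOp d e h' := by
    refine Subtype.ext (LinearMap.ext fun f => Subtype.ext ?_)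
    change algebraMap S K (X v) * pderivK w f =
      algebraMap S K (X v) / algebraMap S K (X v') * (algebraMap S K (X v') * pderivK w f)
    field_simp
  have e2 : divX v' h1' h2' p = g • divX v h1 h2 p := by
    refine Subtype.ext ?_
    change algebraMap S K p / algebraMap S K (X v') =
      algebraMap S K (X v) / algebraMap S K (X v') * (algebraMap S K p / algebraMap S K (X v))
    field_simp
  rw [e1, e2, TensorProduct.smul_tmul]

theorem eulerOp_tmul_divX_mem {d e m n m' n' : ℤ} {v w : Fin 2 ⊕ Fin 2}
    (h : bidegree v = bidegree w) (h1 : m' = m + (bidegree v).1) (h2 : n' = n + (bidegree v).2)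
    (p : bihom m' n') : eulerOp d e h ⊗ₜ[funField] divX v h1 h2 p ∈ H0Sigma d e m n := by
  refine (Submodule.mem_iInf _).2 fun P => ?_
  -- near `P` the tensor is rewritten with a denominator that does not vanish at `P`
  obtain ⟨v', hv', hP⟩ := exists_valAt_X_ne_zero w P
  rw [eulerOp_tmul_divX h hv' h1 h2 (by rw [h1, h, hv']) (by rw [h2, h, hv'])]
  exact Submodule.subset_span ⟨_, isZariskiOpen_ne_zero (X_mem_bihom v'), hP, _,
    eulerOp_mem_sigmaSec _ _, _, divX_mem_sec _ _ _ _, rfl⟩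

/-- A multiple of a partial derivative of `F` is a value of the differential of `F`. -/
theorem mul_pderiv_mem_genJacobian {d e a b m' n' : ℤ} {F : S} (hF : F ∈ bihom d e)
    {G : bihom a b} (w : Fin 2 ⊕ Fin 2) {p : S} (hp : p ∈ bihom m' n')
    (h1 : m' = a - d + (bidegree w).1) (h2 : n' = b - e + (bidegree w).2)
    (hG : (G : S) = p * pderiv w F) :
    polySec a b G ∈ genJacobian a b (polySec d e ⟨F, hF⟩) := by
  refine ⟨⟨_, eulerOp_tmul_divX_mem (rfl : bidegree w = bidegree w) h1 h2 ⟨p, hp⟩⟩, ?_⟩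
  refine Subtype.ext (Subtype.ext ?_)
  change algebraMap S K (X w) * pderivK w (algebraMap S K F) *
    (algebraMap S K p / algebraMap S K (X w)) = algebraMap S K G
  have := algebraMap_X_ne_zero w
  rw [hG, pderivK_algebraMap, map_mul]
  field_simp

theorem map_idealPart_le_genJacobian {d e : ℤ} {F : S} (hF : F ∈ bihom d e) (a b : ℤ) :
    (idealPart (jacobianIdeal F) a b).map (polySec a b) ≤
      genJacobian a b (polySec d e ⟨F, hF⟩) := by
  rintro _ ⟨⟨G, hG⟩, hG', rfl⟩
  obtain ⟨P₀, hP₀, P₁, hP₁, Q₀, hQ₀, Q₁, hQ₁, rfl⟩ := (mem_jacobianIdeal_iff hF hG).1 hG'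
  have hx (i : Fin 2) {p : S} (hp : p ∈ bihom (a - d + 1) (b - e)) : p * dx i F ∈ bihom a b := by
    convert bihom_mul hp (dx_mem_bihom hF i) using 1
    ring_nf
  have hy (j : Fin 2) {p : S} (hp : p ∈ bihom (a - d) (b - e + 1)) : p * dy j F ∈ bihom a b := by
    convert bihom_mul hp (dy_mem_bihom hF j) using 1
    ring_nf
  have e : (⟨_, hG⟩ : bihom a b) = ⟨_, hx 0 hP₀⟩ + ⟨_, hx 1 hP₁⟩ + ⟨_, hy 0 hQ₀⟩ + ⟨_, hy 1 hQ₁⟩ :=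
    rfl
  rw [e, map_add, map_add, map_add]
  refine add_mem (add_mem (add_mem ?_ ?_) ?_) ?_
  · exact mul_pderiv_mem_genJacobian hF (.inl 0) hP₀ rfl (add_zero _).symm rfl
  · exact mul_pderiv_mem_genJacobian hF (.inl 1) hP₁ rfl (add_zero _).symm rfl
  · exact mul_pderiv_mem_genJacobian hF (.inr 0) hQ₀ (add_zero _).symm rfl rfl
  · exact mul_pderiv_mem_genJacobian hF (.inr 1) hQ₁ (add_zero _).symm rfl rfl

/-! ### Regular first-order operators and their symbols -/

/-- `T` is a differential operator of order at most one from `𝒪(d, e)` to `𝒪(a, b)` that maps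
sections regular at a point to sections regular at this point: a global section of
`Σ_L ⊗ L^∨ ⊗ M`, seen as an operator. Its values are taken in the field `K`. -/
structure IsRegularOp {d e : ℤ} (a b : ℤ) (T : ratSec d e →ₗ[ℂ] K) : Prop where
  first_order : ∀ (g h : funField) (f : ratSec d e),
    T (g • h • f) - g * T (h • f) - h * T (g • f) + g * (h * T f) = 0
  regular : ∀ (P : Pt) (f : ratSec d e), RegularAt P f → IsQuot (nonzeroAt P) a b (T f)

/-- The operator `σ ↦ (dσ)(t)` attached to an element `t` of the generic stalk of
`Σ_L ⊗ L^∨ ⊗ M`. -/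
def opOfTensor {d e : ℤ} (a b : ℤ) (t : ratSigma d e ⊗[funField] ratSec (a - d) (b - e)) :
    ratSec d e →ₗ[ℂ] K where
  toFun f := ratDiff a b f t
  map_add' f g := by
    induction t with
    | zero => simp
    | tmul D r =>
      change ((D.1 (f + g) : ratSec d e) : K) * (r : K) = (D.1 f : K) * r + (D.1 g : K) * r
      rw [map_add]
      exact add_mul _ _ _
    | add t s ht hs =>
      simp only [map_add, Submodule.coe_add, ht, hs]
      ring
  map_smul' c f := by
    induction t with
    | zero => simp
    | tmul D r =>
      change ((D.1 (c • f) : ratSec d e) : K) * (r : K) = c • ((D.1 f : K) * r)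
      rw [map_smul]
      exact smul_mul_assoc _ _ _
    | add t s ht hs =>
      simp only [map_add, Submodule.coe_add, ht, hs, smul_add]

theorem opOfTensor_tmul {d e a b : ℤ} (D : ratSigma d e) (r : ratSec (a - d) (b - e))
    (f : ratSec d e) : opOfTensor a b (D ⊗ₜ[funField] r) f = (D.1 f : K) * r := rfl

theorem opOfTensor_add {d e a b : ℤ} (t s : ratSigma d e ⊗[funField] ratSec (a - d) (b - e))
    (f : ratSec d e) : opOfTensor a b (t + s) f = opOfTensor a b t f + opOfTensor a b s f := by
  change ((ratDiff a b f (t + s) : ratSec a b) : K) = _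
  rw [map_add]
  rfl

theorem opOfTensor_smul {d e a b : ℤ} (c : ℂ)
    (t : ratSigma d e ⊗[funField] ratSec (a - d) (b - e)) (f : ratSec d e) :
    opOfTensor a b (c • t) f = c • opOfTensor a b t f := by
  change (((ratDiff a b f).restrictScalars ℂ (c • t) : ratSec a b) : K) = _
  rw [map_smul]
  rfl

theorem isRegularOp_opOfTensor {d e a b : ℤ}
    {t : ratSigma d e ⊗[funField] ratSec (a - d) (b - e)} (ht : t ∈ H0Sigma d e (a - d) (b - e)) :
    IsRegularOp a b (opOfTensor a b t) where
  first_order g h f := by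
    clear ht
    induction t with
    | zero =>
      have h0 (f : ratSec d e) : opOfTensor a b 0 f = 0 := by
        change ((ratDiff a b f 0 : ratSec a b) : K) = 0
        rw [map_zero]
        rfl
      simp [h0]
    | tmul D r =>
      simp only [opOfTensor_tmul]
      have hD : ((D.1 (g • h • f) : ratSec d e) : K) - g * (D.1 (h • f) : ratSec d e)
          - h * (D.1 (g • f) : ratSec d e) + g * (h * (D.1 f : ratSec d e)) = 0 :=
        congrArg Subtype.val (D.2 g h f)
      linear_combination (r : K) * hD
    | add t s ht hs =>
      simp only [opOfTensor_add]
      linear_combination ht + hs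
  regular P f hf := by
    have ht' := (Submodule.mem_iInf _).1 ht P
    clear ht
    induction ht' using Submodule.span_induction with
    | mem t h =>
      obtain ⟨V, hV, hP, D, hD, r, hr, rfl⟩ := h
      -- `f` is a section over the set where its denominator does not vanish
      obtain ⟨i, j, p, q, hp, hq, hq0, hg, hfq⟩ := hf
      have hD' := hD _ (isZariskiOpen_inter_ne_zero hV hq) Set.inter_subset_left f
        (fun Q hQ => ⟨i, j, p, q, hp, hq, hq0, hQ.2, hfq⟩) P ⟨hP, hg⟩
      exact IsQuot.mul (nonzeroAt_mul P) (add_sub_cancel d a) (add_sub_cancel e b) hD' (hr P hP)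
    | zero =>
      change IsQuot _ a b ((ratDiff a b f 0 : ratSec a b) : K)
      rw [map_zero]
      exact (sec a b {P}).zero_mem P rfl
    | add t s _ _ ht hs =>
      rw [opOfTensor_add]
      exact ht.add (nonzeroAt_mul P) hs
    | smul c t _ ht =>
      rw [opOfTensor_smul, Algebra.smul_def]
      exact IsQuot.mul (nonzeroAt_mul P) (zero_add a) (zero_add b)
        (IsQuot.const (nonzeroAt_one P) c) ht

theorem IsQuot.inv {m n : ℤ} {r : K} (hr : IsQuot anyDen m n r) (h0 : r ≠ 0) :
    IsQuot anyDen (-m) (-n) r⁻¹ := by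
  obtain ⟨i, j, p, q, hp, hq, -, -, rfl⟩ := hr
  refine ⟨i + m, j + n, q, p, by simpa using hq, hp, ?_, trivial, inv_div _ _⟩
  rintro rfl
  simp at h0

/-- The symbol of a first-order operator `T`: the derivation `X` of the function field with
`T (g f) = g T f + X(g) f`. -/
theorem IsRegularOp.exists_symbol {d e a b : ℤ} {T : ratSec d e →ₗ[ℂ] K} (hT : IsRegularOp a b T)
    (f₀ : ratSec d e) (hf₀ : (f₀ : K) ≠ 0) :
    ∃ X : funField → K, ∀ (g : funField) (f : ratSec d e), T (g • f) = g * T f + X g * f := by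
  refine ⟨fun g => (T (g • f₀) - g * T f₀) / f₀, fun g f => ?_⟩
  let h : funField := ⟨f * (f₀ : K)⁻¹,
    IsQuot.mul anyDen_mul (add_neg_cancel d) (add_neg_cancel e) f.2 (f₀.2.inv hf₀)⟩
  have hf : f = h • f₀ := Subtype.ext <| by
    change (f : K) = (f : K) * (f₀ : K)⁻¹ * f₀
    field_simp
  have e1 := hT.first_order g h f₀
  have e2 : (f : K) = (h : K) * f₀ := congrArg Subtype.val hf
  rw [← hf] at e1
  rw [e2]
  field_simp
  linear_combination e1

/-- The symbol satisfies the Leibniz rule. -/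
theorem symbol_mul {d e : ℤ} {T : ratSec d e →ₗ[ℂ] K} {X : funField → K}
    (hX : ∀ (g : funField) (f : ratSec d e), T (g • f) = g * T f + X g * f)
    {f₀ : ratSec d e} (hf₀ : (f₀ : K) ≠ 0) (g h : funField) : X (g * h) = g * X h + h * X g := by
  have h1 := hX (g * h) f₀
  have h2 := hX g (h • f₀)
  rw [mul_smul, h2, hX h f₀] at h1
  have h3 : ((h • f₀ : ratSec d e) : K) = (h : K) * f₀ := rfl
  have h4 : ((g * h : funField) : K) = (g : K) * h := rfl
  rw [h3, h4] at h1
  apply mul_right_cancel₀ hf₀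
  linear_combination -h1

theorem symbol_one {X : funField → K} (hX : ∀ g h, X (g * h) = (g : K) * X h + (h : K) * X g) :
    X 1 = 0 := by
  have h := hX 1 1
  have h1 : ((1 : funField) : K) = 1 := rfl
  rw [h1, mul_one] at h
  linear_combination -h

theorem symbol_pow {X : funField → K} (hX : ∀ g h, X (g * h) = (g : K) * X h + (h : K) * X g)
    (g : funField) (k : ℕ) : (g : K) * X (g ^ k) = k * (g : K) ^ k * X g := by
  induction k with
  | zero => simp [symbol_one hX]
  | succ k ih =>
    have h1 : ((g ^ k : funField) : K) = (g : K) ^ k := rfl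
    rw [pow_succ, hX, h1]
    push_cast
    linear_combination (g : K) * ih

/-- The rational function `X_v / X_w`, for variables `v` and `w` of the same bidegree. -/
def ratio {v w : Fin 2 ⊕ Fin 2} (h : bidegree v = bidegree w) : funField :=
  ⟨algebraMap S K (X v) / algebraMap S K (X w),
    IsQuot.div anyDen_mul (IsQuot.of_poly anyDen_one (X_mem_bihom v)) (X_mem_bihom w)
      (X_ne_zero w) trivial (by rw [h, zero_add]) (by rw [h, zero_add])⟩

theorem coe_ratio {v w : Fin 2 ⊕ Fin 2} (h : bidegree v = bidegree w) :
    (ratio h : K) = algebraMap S K (X v) / algebraMap S K (X w) := rfl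

theorem ratio_regular {v w : Fin 2 ⊕ Fin 2} (h : bidegree v = bidegree w) {P : Pt}
    (hP : valAt P (X w) ≠ 0) : IsQuot (nonzeroAt P) 0 0 (ratio h : K) :=
  IsQuot.div (nonzeroAt_mul P) (IsQuot.of_poly (nonzeroAt_one P) (X_mem_bihom v)) (X_mem_bihom w)
    (X_ne_zero w) hP (by rw [h, zero_add]) (by rw [h, zero_add])

theorem x_pow_mul_y_pow_mem (d e : ℕ) (i j : Fin 2) :
    (X (.inl i) ^ d * X (.inr j) ^ e : S) ∈ bihom d e := by
  have h1 := (mem_bihom_iff.1 (x_mem_bihom i)).pow d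
  have h2 := (mem_bihom_iff.1 (y_mem_bihom j)).pow e
  have := bihom_mul (m := d) (n := 0) (m' := 0) (n' := e)
    (mem_bihom_iff.2 (by convert h1 using 1; simp))
    (mem_bihom_iff.2 (by convert h2 using 1; simp))
  simpa using this

/-- The section `x_i ^ d * y_j ^ e` of `𝒪(d, e)`. -/
def frame (d e : ℕ) (i j : Fin 2) : bihom d e := ⟨_, x_pow_mul_y_pow_mem d e i j⟩

theorem coe_frame (d e : ℕ) (i j : Fin 2) :
    (frame d e i j : S) = X (.inl i) ^ d * X (.inr j) ^ e := rfl

theorem frame_ne_zero (d e : ℕ) (i j : Fin 2) : (frame d e i j : S) ≠ 0 :=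
  mul_ne_zero (pow_ne_zero _ (X_ne_zero _)) (pow_ne_zero _ (X_ne_zero _))

theorem valAt_frame_ne_zero (d e : ℕ) {i j : Fin 2} {P : Pt} (hi : valAt P (X (.inl i)) ≠ 0)
    (hj : valAt P (X (.inr j)) ≠ 0) : valAt P (frame d e i j) ≠ 0 := by
  rw [coe_frame, map_mul, map_pow, map_pow]
  exact mul_ne_zero (pow_ne_zero _ hi) (pow_ne_zero _ hj)

/-- A bihomogeneous polynomial as a rational section. -/
abbrev polyRat (d e : ℤ) : bihom d e →ₗ[ℂ] ratSec d e := (H0 d e).subtype ∘ₗ polySec d e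

theorem coe_polyRat {d e : ℤ} (p : bihom d e) : (polyRat d e p : K) = algebraMap S K p := rfl

theorem regularAt_polyRat {d e : ℤ} (P : Pt) (p : bihom d e) : RegularAt P (polyRat d e p) :=
  (polySec d e p).2 P trivial

/-- The symbol maps functions regular at `P` to sections of `𝒪(a - d, b - e)` regular at `P`. -/
theorem symbol_regular {d e : ℕ} {a b : ℤ} {T : ratSec d e →ₗ[ℂ] K} (hT : IsRegularOp a b T)
    {X : funField → K} (hX : ∀ (g : funField) (f : ratSec d e), T (g • f) = g * T f + X g * f)
    {P : Pt} {g : funField} (hg : IsQuot (nonzeroAt P) 0 0 (g : K)) :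
    IsQuot (nonzeroAt P) (a - d) (b - e) (X g) := by
  obtain ⟨i, hi⟩ := exists_x_ne_zero P
  obtain ⟨j, hj⟩ := exists_y_ne_zero P
  have hf := regularAt_polyRat P (frame d e i j)
  have hgf : RegularAt P (g • polyRat d e (frame d e i j)) :=
    IsQuot.mul (nonzeroAt_mul P) (zero_add _) (zero_add _) hg hf
  have h0 : algebraMap S K (frame d e i j) ≠ 0 := by simpa using frame_ne_zero d e i j
  have e1 : X g = (T (g • polyRat d e (frame d e i j)) - g * T (polyRat d e (frame d e i j))) /
      algebraMap S K (frame d e i j) := by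
    rw [hX, coe_polyRat]
    field_simp
    ring
  rw [e1]
  refine IsQuot.div (nonzeroAt_mul P) ((hT.regular P _ hgf).sub (nonzeroAt_mul P)
    (IsQuot.mul (nonzeroAt_mul P) (zero_add a) (zero_add b) hg (hT.regular P _ hf)))
    (frame d e i j).2 (frame_ne_zero d e i j) (valAt_frame_ne_zero d e hi hj) ?_ ?_ <;> ring

/-- For the symbol `X` of a regular operator and variables `v₀, v₁` of one factor, the expression
`X(v₁ / v₀) v₀²` is regular everywhere; it is written `ξ v₀ v₁` with `ξ` the logarithmic
derivative of `v₁ / v₀`. -/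
theorem symbol_ratio_regular {d e : ℕ} {a b : ℤ} {T : ratSec d e →ₗ[ℂ] K} (hT : IsRegularOp a b T)
    {X : funField → K} (hX : ∀ (g : funField) (f : ratSec d e), T (g • f) = g * T f + X g * f)
    {v₀ v₁ : Fin 2 ⊕ Fin 2} (h : bidegree v₁ = bidegree v₀)
    (hv : ∀ P, valAt P (MvPolynomial.X v₀) ≠ 0 ∨ valAt P (MvPolynomial.X v₁) ≠ 0) (P : Pt) :
    IsQuot (nonzeroAt P) (a - d + (bidegree v₀).1 + (bidegree v₀).1)
      (b - e + (bidegree v₀).2 + (bidegree v₀).2)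
      (X (ratio h) / ratio h * algebraMap S K (MvPolynomial.X v₀) *
        algebraMap S K (MvPolynomial.X v₁)) := by
  have h0 := algebraMap_X_ne_zero v₀
  have h1 := algebraMap_X_ne_zero v₁
  have hpoly (w) : IsQuot (nonzeroAt P) (bidegree w).1 (bidegree w).2
      (algebraMap S K (MvPolynomial.X w)) := IsQuot.of_poly (nonzeroAt_one P) (X_mem_bihom w)
  have hmul (w) (hw : bidegree w = bidegree v₀) {r : K}
      (hr : IsQuot (nonzeroAt P) (a - d) (b - e) r) :
      IsQuot (nonzeroAt P) (a - d + (bidegree v₀).1 + (bidegree v₀).1)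
        (b - e + (bidegree v₀).2 + (bidegree v₀).2)
        (r * algebraMap S K (MvPolynomial.X w) * algebraMap S K (MvPolynomial.X w)) := by
    rw [← hw]
    exact IsQuot.mul (nonzeroAt_mul P) rfl rfl
      (IsQuot.mul (nonzeroAt_mul P) rfl rfl hr (hpoly w)) (hpoly w)
  rcases hv P with hP | hP
  · convert hmul v₀ rfl (symbol_regular hT hX (ratio_regular h hP)) using 1
    rw [coe_ratio]
    field_simp
  · convert (hmul v₁ h (symbol_regular hT hX (ratio_regular h.symm hP))).neg using 1
    have hf₀ : ((polyRat d e (frame d e 0 0) : ratSec d e) : K) ≠ 0 := by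
      rw [coe_polyRat]
      simpa using frame_ne_zero d e 0 0
    have hL := symbol_mul hX hf₀
    -- the Leibniz rule for `(v₁ / v₀) (v₀ / v₁) = 1` carries the claim to the other chart
    have e1 : ratio h * ratio h.symm = 1 := Subtype.ext <| by
      change algebraMap S K (MvPolynomial.X v₁) / algebraMap S K (MvPolynomial.X v₀) *
        (algebraMap S K (MvPolynomial.X v₀) / algebraMap S K (MvPolynomial.X v₁)) = 1
      field_simp
    have e2 := hL (ratio h) (ratio h.symm)
    rw [e1, symbol_one hL, coe_ratio, coe_ratio] at e2
    rw [coe_ratio]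
    field_simp at e2 ⊢
    linear_combination -e2

/-- The operator on monomials, in terms of its value on the frame `x₀ ^ d * y₀ ^ e` and of the
logarithmic derivatives of `x₁ / x₀` and `y₁ / y₀`. -/
theorem op_monomial {d e : ℕ} {T : ratSec d e →ₗ[ℂ] K}
    {X : funField → K} (hX : ∀ (g : funField) (f : ratSec d e), T (g • f) = g * T f + X g * f)
    (hx : bidegree (.inl 1) = bidegree (.inl 0)) (hy : bidegree (.inr 1) = bidegree (.inr 0))
    {α : Fin 2 ⊕ Fin 2 →₀ ℕ} (hα : monomial α 1 ∈ bihom d e) :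
    T (polyRat d e ⟨monomial α 1, hα⟩) = algebraMap S K (monomial α 1) *
      (T (polyRat d e (frame d e 0 0)) / algebraMap S K (frame d e 0 0)
        + α (.inl 1) * (X (ratio hx) / ratio hx) + α (.inr 1) * (X (ratio hy) / ratio hy)) := by
  have h00 : algebraMap S K (frame d e 0 0) ≠ 0 := by simpa using frame_ne_zero d e 0 0
  have hL := symbol_mul hX (f₀ := polyRat d e (frame d e 0 0)) (by rwa [coe_polyRat])
  have hw := mem_bihom_iff.1 hα (d := α) (by simp)
  rw [weight_bidegree, Prod.mk.injEq] at hw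
  have h0 := algebraMap_X_ne_zero (.inl 0)
  have h1 := algebraMap_X_ne_zero (.inl 1)
  have h2 := algebraMap_X_ne_zero (.inr 0)
  have h3 := algebraMap_X_ne_zero (.inr 1)
  have hu : (ratio hx : K) ≠ 0 := div_ne_zero h1 h0
  have hv : (ratio hy : K) ≠ 0 := div_ne_zero h3 h2
  have hmon : algebraMap S K (monomial α 1) =
      (ratio hx : K) ^ α (.inl 1) * (ratio hy : K) ^ α (.inr 1) *
        algebraMap S K (frame d e 0 0) := by
    have hd : d = α (.inl 0) + α (.inl 1) := by omega
    have he : e = α (.inr 0) + α (.inr 1) := by omega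
    rw [coe_frame, monomial_eq, Finsupp.prod_fintype _ _ (by simp), coe_ratio, coe_ratio, hd, he]
    simp only [Fintype.prod_sum_type, Fin.prod_univ_two, C_1, one_mul, map_mul, map_pow, pow_add,
      div_pow]
    field_simp
  have c1 : ((ratio hx ^ α (.inl 1) : funField) : K) = (ratio hx : K) ^ α (.inl 1) := rfl
  have c2 : ((ratio hy ^ α (.inr 1) : funField) : K) = (ratio hy : K) ^ α (.inr 1) := rfl
  have c3 : ((ratio hx ^ α (.inl 1) * ratio hy ^ α (.inr 1) : funField) : K) =
    (ratio hx : K) ^ α (.inl 1) * (ratio hy : K) ^ α (.inr 1) := rfl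
  have hsec : polyRat d e ⟨monomial α 1, hα⟩ =
      (ratio hx ^ α (.inl 1) * ratio hy ^ α (.inr 1)) • polyRat d e (frame d e 0 0) := by
    refine Subtype.ext (hmon.trans ?_)
    rw [← c3]
    rfl
  have p1 := symbol_pow hL (ratio hx) (α (.inl 1))
  have p2 := symbol_pow hL (ratio hy) (α (.inr 1))
  have hξ : X (ratio hx ^ α (.inl 1)) =
      α (.inl 1) * (ratio hx : K) ^ α (.inl 1) * (X (ratio hx) / ratio hx) := by
    rw [← mul_div_assoc, ← p1, mul_div_cancel_left₀ _ hu]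
  have hη : X (ratio hy ^ α (.inr 1)) =
      α (.inr 1) * (ratio hy : K) ^ α (.inr 1) * (X (ratio hy) / ratio hy) := by
    rw [← mul_div_assoc, ← p2, mul_div_cancel_left₀ _ hv]
  rw [hsec, hX, hL, c1, c2, c3, hξ, hη, coe_polyRat, hmon]
  generalize X (ratio hx) / ratio hx = ξ
  generalize X (ratio hy) / ratio hy = η
  generalize T (polyRat d e (frame d e 0 0)) = t
  field_simp
  ring

/-- Operators that act on monomials as in `op_monomial` act on every form by
`R + ξ x₁ ∂/∂x₁ + η y₁ ∂/∂y₁`. -/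
theorem op_eq_of_monomial {d e : ℤ} {T : bihom d e →ₗ[ℂ] K} {R ξ η : K}
    (hT : ∀ (α : Fin 2 ⊕ Fin 2 →₀ ℕ) (hα : monomial α 1 ∈ bihom d e), T ⟨monomial α 1, hα⟩ =
      algebraMap S K (monomial α 1) * (R + α (.inl 1) * ξ + α (.inr 1) * η)) (F : bihom d e) :
    T F = algebraMap S K F * R + algebraMap S K (X (.inl 1) * dx 1 F) * ξ
      + algebraMap S K (X (.inr 1) * dy 1 F) * η := by
  let ι : S →ₗ[ℂ] K := (IsScalarTower.toAlgHom ℂ S K).toLinearMap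
  let D (v : Fin 2 ⊕ Fin 2) : S →ₗ[ℂ] S :=
    (LinearMap.mulLeft ℂ (X v : S)).comp (pderiv v).toLinearMap
  let g : S →ₗ[ℂ] K := (LinearMap.mulRight ℂ R).comp ι
    + (LinearMap.mulRight ℂ ξ).comp (ι.comp (D (.inl 1)))
    + (LinearMap.mulRight ℂ η).comp (ι.comp (D (.inr 1)))
  have hg (p : S) : g p = algebraMap S K p * R + algebraMap S K (X (.inl 1) * dx 1 p) * ξ
      + algebraMap S K (X (.inr 1) * dy 1 p) * η := rfl
  have H : T = g.comp (bihom d e).subtype := by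
    refine bihom_linear_ext fun α hα => ?_
    rw [hT, LinearMap.comp_apply, Submodule.subtype_apply, hg, dx, dy, X_mul_pderiv_monomial,
      X_mul_pderiv_monomial, map_nsmul, map_nsmul, nsmul_eq_mul, nsmul_eq_mul]
    ring
  rw [H, LinearMap.comp_apply, Submodule.subtype_apply, hg]

/-! ### The differential takes values in the Jacobian ideal -/

/-- The Čech argument behind the vanishing of global sections: if `r` is regular where `v₀ ≠ 0` and
`r + s` is regular where `v₁ ≠ 0`, and if `s v₀ v₁` is regular everywhere, then `r v₀` and `s v₁`
are regular everywhere, so that `r` and `s` vanish if there are no sections in this bidegree. -/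
theorem eq_zero_of_regular {m n : ℤ} {v₀ v₁ : Fin 2 ⊕ Fin 2} (h : bidegree v₁ = bidegree v₀)
    (hv : ∀ P, valAt P (X v₀) ≠ 0 ∨ valAt P (X v₁) ≠ 0) {r s : K}
    (hr : ∀ P, valAt P (X v₀) ≠ 0 → IsQuot (nonzeroAt P) m n r)
    (hrs : ∀ P, valAt P (X v₁) ≠ 0 → IsQuot (nonzeroAt P) m n (r + s))
    (hs : ∀ P, IsQuot (nonzeroAt P) (m + (bidegree v₀).1 + (bidegree v₀).1)
      (n + (bidegree v₀).2 + (bidegree v₀).2)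
      (s * algebraMap S K (X v₀) * algebraMap S K (X v₁)))
    (hneg : m + (bidegree v₀).1 < 0 ∨ n + (bidegree v₀).2 < 0) : r = 0 ∧ s = 0 := by
  have h0 := algebraMap_X_ne_zero v₀
  have h1 := algebraMap_X_ne_zero v₁
  have hdiv (P : Pt) {w : Fin 2 ⊕ Fin 2} (hw : bidegree w = bidegree v₀)
      (hP : valAt P (X w) ≠ 0) :
      IsQuot (nonzeroAt P) (m + (bidegree v₀).1) (n + (bidegree v₀).2)
        (s * algebraMap S K (X v₀) * algebraMap S K (X v₁) / algebraMap S K (X w)) :=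
    (hs P).div (nonzeroAt_mul P) (X_mem_bihom w) (X_ne_zero w) hP (by rw [hw]) (by rw [hw])
  have hmul (P : Pt) (w : Fin 2 ⊕ Fin 2) (hw : bidegree w = bidegree v₀) {t : K}
      (ht : IsQuot (nonzeroAt P) m n t) :
      IsQuot (nonzeroAt P) (m + (bidegree v₀).1) (n + (bidegree v₀).2)
        (t * algebraMap S K (X w)) := by
    rw [← hw]
    exact IsQuot.mul (nonzeroAt_mul P) rfl rfl ht
      (IsQuot.of_poly (nonzeroAt_one P) (X_mem_bihom w))
  have hzero {t : K} (ht : ∀ P, IsQuot (nonzeroAt P) (m + (bidegree v₀).1)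
      (n + (bidegree v₀).2) t) : t = 0 := by
    obtain ⟨p, hp, rfl⟩ := exists_poly_of_regular ht
    rw [eq_zero_of_mem_bihom hp hneg, map_zero]
  have hr0 : r = 0 := by
    refine (mul_eq_zero.1 (hzero (t := r * algebraMap S K (X v₀)) fun P => ?_)).resolve_right h0
    rcases hv P with hP | hP
    · exact hmul P v₀ rfl (hr P hP)
    · convert (hmul P v₀ rfl (hrs P hP)).sub (nonzeroAt_mul P) (hdiv P h hP) using 1
      field_simp
      ring
  refine ⟨hr0, ?_⟩
  refine (mul_eq_zero.1 (hzero (t := s * algebraMap S K (X v₁)) fun P => ?_)).resolve_right h1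
  rcases hv P with hP | hP
  · convert hdiv P rfl hP using 1
    field_simp
  · convert hmul P v₁ h (hrs P hP) using 1
    rw [hr0, zero_add]

/-- The value of a regular first-order operator on `F` lies in the Jacobian ideal of `F`, in terms of
the local data `R`, `ξ`, `η` of the operator. If the twist `(m, n)` has no component below `-1`,
then `ξ` and `η` come from homogeneous vector fields with polynomial coefficients, and the rest of
the operator is a global section of `𝒪(m, n)`; otherwise the value is zero. -/
theorem mem_jacobianIdeal_of_local_data {d e : ℕ} {m n : ℤ} {F G : S} (hF : F ∈ bihom d e)
    (hirr : Irreducible F) {R ξ η : K}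
    (hR : ∀ P i j, valAt P (X (.inl i)) ≠ 0 → valAt P (X (.inr j)) ≠ 0 →
      IsQuot (nonzeroAt P) m n (R + (if i = 1 then d * ξ else 0) + (if j = 1 then e * η else 0)))
    (hξ : ∀ P, IsQuot (nonzeroAt P) (m + 1 + 1) n
      (ξ * algebraMap S K (X (.inl 0)) * algebraMap S K (X (.inl 1))))
    (hη : ∀ P, IsQuot (nonzeroAt P) m (n + 1 + 1)
      (η * algebraMap S K (X (.inr 0)) * algebraMap S K (X (.inr 1))))
    (hG : algebraMap S K G = algebraMap S K F * R + algebraMap S K (X (.inl 1) * dx 1 F) * ξ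
      + algebraMap S K (X (.inr 1) * dy 1 F) * η) : G ∈ jacobianIdeal F := by
  have x0 := algebraMap_X_ne_zero (.inl 0)
  have x1 := algebraMap_X_ne_zero (.inl 1)
  have y0 := algebraMap_X_ne_zero (.inr 0)
  have y1 := algebraMap_X_ne_zero (.inr 1)
  have hvx (P : Pt) : valAt P (X (.inl 0)) ≠ 0 ∨ valAt P (X (.inl 1)) ≠ 0 := by
    obtain ⟨i, hi⟩ := exists_x_ne_zero P
    fin_cases i
    exacts [.inl hi, .inr hi]
  have hvy (P : Pt) : valAt P (X (.inr 0)) ≠ 0 ∨ valAt P (X (.inr 1)) ≠ 0 := by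
    obtain ⟨i, hi⟩ := exists_y_ne_zero P
    fin_cases i
    exacts [.inl hi, .inr hi]
  obtain ⟨A, hA, hAξ⟩ := exists_poly_of_regular hξ
  obtain ⟨B, hB, hBη⟩ := exists_poly_of_regular hη
  have hG0 (h : algebraMap S K G = 0) : G ∈ jacobianIdeal F := by
    rw [(map_eq_zero_iff _ algebraMap_injective).1 h]
    exact zero_mem _
  -- For `n ≤ -2` there are no nonzero forms of bidegree `(m + 2, n)` or `(m, n + 1)`.
  by_cases hn : n < -1
  · have hξ0 : ξ = 0 := by
      rw [eq_zero_of_mem_bihom hA (by omega), map_zero] at hAξ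
      simpa [x0, x1] using hAξ
    have hRη : R = 0 ∧ (e : K) * η = 0 := by
      refine eq_zero_of_regular (m := m) (n := n) (v₀ := .inr 0) (v₁ := .inr 1) rfl hvy
        (fun P hP => ?_) (fun P hP => ?_) (fun P => ?_) (.inr (by simp [bidegree]; omega))
      · obtain ⟨i, hi⟩ := exists_x_ne_zero P
        simpa [hξ0] using hR P i 0 hi hP
      · obtain ⟨i, hi⟩ := exists_x_ne_zero P
        simpa [hξ0] using hR P i 1 hi hP
      · have := IsQuot.mul (nonzeroAt_mul P) (zero_add _) (zero_add _)
          (IsQuot.const (nonzeroAt_one P) (e : ℂ)) (hη P)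
        simpa [bidegree, mul_assoc] using this
    apply hG0
    rw [hG, hRη.1, hξ0]
    rcases mul_eq_zero.1 hRη.2 with h | h
    · have he : (algebraMap ℂ K) e = 0 := by simpa using h
      have he0 : e = 0 := Nat.cast_eq_zero.1 ((map_eq_zero _).1 he)
      subst he0
      rw [eq_zero_of_mem_bihom (dy_mem_bihom hF 1) (by simp)]
      simp
    · simp [h]
  by_cases hm : m < -1
  · have hη0 : η = 0 := by
      rw [eq_zero_of_mem_bihom hB (by omega), map_zero] at hBη
      simpa [y0, y1] using hBη
    have hRξ : R = 0 ∧ (d : K) * ξ = 0 := by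
      refine eq_zero_of_regular (m := m) (n := n) (v₀ := .inl 0) (v₁ := .inl 1) rfl hvx
        (fun P hP => ?_) (fun P hP => ?_) (fun P => ?_) (.inl (by simp [bidegree]; omega))
      · obtain ⟨j, hj⟩ := exists_y_ne_zero P
        simpa [hη0] using hR P 0 j hP hj
      · obtain ⟨j, hj⟩ := exists_y_ne_zero P
        simpa [hη0] using hR P 1 j hP hj
      · have := IsQuot.mul (nonzeroAt_mul P) (zero_add _) (zero_add _)
          (IsQuot.const (nonzeroAt_one P) (d : ℂ)) (hξ P)
        simpa [bidegree, mul_assoc] using this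
    apply hG0
    rw [hG, hRξ.1, hη0]
    rcases mul_eq_zero.1 hRξ.2 with h | h
    · have hd : (algebraMap ℂ K) d = 0 := by simpa using h
      have hd0 : d = 0 := Nat.cast_eq_zero.1 ((map_eq_zero _).1 hd)
      subst hd0
      rw [eq_zero_of_mem_bihom (dx_mem_bihom hF 1) (by simp)]
      simp
    · simp [h]
  obtain ⟨P₀, hP₀, P₁, hP₁, rfl⟩ := exists_eq_x_mul_sub (by omega) hA
  obtain ⟨Q₀, hQ₀, Q₁, hQ₁, rfl⟩ := exists_eq_y_mul_sub (by omega) hB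
  rw [add_sub_cancel_right] at hP₀ hP₁ hQ₀ hQ₁
  rw [map_sub, map_mul, map_mul] at hAξ hBη
  have hξ' : ξ = algebraMap S K P₁ / algebraMap S K (X (.inl 1))
      - algebraMap S K P₀ / algebraMap S K (X (.inl 0)) := by
    field_simp
    linear_combination hAξ
  have hη' : η = algebraMap S K Q₁ / algebraMap S K (X (.inr 1))
      - algebraMap S K Q₀ / algebraMap S K (X (.inr 0)) := by
    field_simp
    linear_combination hBη
  obtain ⟨c, hc, hRc⟩ : ∃ c ∈ bihom m n, R - d * (algebraMap S K P₀ / algebraMap S K (X (.inl 0)))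
      - e * (algebraMap S K Q₀ / algebraMap S K (X (.inr 0))) = algebraMap S K c := by
    refine exists_poly_of_regular fun P => ?_
    obtain ⟨i, hi⟩ := exists_x_ne_zero P
    obtain ⟨j, hj⟩ := exists_y_ne_zero P
    have hsub {p w : S} {k l k' l' : ℤ} (q : ℕ) (hp : p ∈ bihom k l) (hw : w ∈ bihom k' l')
        (h1 : k = m + k') (h2 : l = n + l') (hP : valAt P w ≠ 0) : IsQuot (nonzeroAt P) m n
          (q * (algebraMap S K p / algebraMap S K w)) := by
      have hw0 : w ≠ 0 := by
        rintro rfl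
        simp at hP
      have := IsQuot.mul (nonzeroAt_mul P) (zero_add _) (zero_add _)
        (IsQuot.const (nonzeroAt_one P) (q : ℂ))
        (IsQuot.div (nonzeroAt_mul P) (IsQuot.of_poly (nonzeroAt_one P) hp) hw hw0 hP h1 h2)
      simpa using this
    have hPi : (if i = 1 then P₁ else P₀) ∈ bihom (m + 1) n := by split_ifs <;> assumption
    have hQj : (if j = 1 then Q₁ else Q₀) ∈ bihom m (n + 1) := by split_ifs <;> assumption
    have key := ((hR P i j hi hj).sub (nonzeroAt_mul P)
      (hsub d hPi (x_mem_bihom i) rfl (add_zero n).symm hi)).sub (nonzeroAt_mul P)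
      (hsub e hQj (y_mem_bihom j) (add_zero m).symm rfl hj)
    -- on the chart `x_i y_j ≠ 0` the expression is the same with `P_i` and `Q_j`
    convert key using 1
    fin_cases i <;> fin_cases j <;> simp [hξ', hη'] <;> ring
  have ex : algebraMap S K (X (.inl 0)) * algebraMap S K (dx 0 F)
      + algebraMap S K (X (.inl 1)) * algebraMap S K (dx 1 F) = d * algebraMap S K F := by
    rw [← map_mul, ← map_mul, ← map_add, euler_x hF, map_mul, algebraMap_const]
    simp
  have ey : algebraMap S K (X (.inr 0)) * algebraMap S K (dy 0 F)
      + algebraMap S K (X (.inr 1)) * algebraMap S K (dy 1 F) = e * algebraMap S K F := by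
    rw [← map_mul, ← map_mul, ← map_add, euler_y hF, map_mul, algebraMap_const]
    simp
  have hfin : G = c * F + (P₀ * dx 0 F + P₁ * dx 1 F + Q₀ * dy 0 F + Q₁ * dy 1 F) := by
    apply algebraMap_injective
    rw [hG]
    simp only [map_add, map_mul]
    rw [← hRc, hξ', hη']
    field_simp
    linear_combination (-algebraMap S K P₀ * algebraMap S K (X (.inr 0))) * ex
      - algebraMap S K Q₀ * algebraMap S K (X (.inl 0)) * ey
  -- Euler's identities also put the multiple `c F` into the Jacobian ideal.
  rw [hfin]
  have hs (p : S) (h : p ∈ ({dx 0 F, dx 1 F, dy 0 F, dy 1 F} : Set S)) : p ∈ jacobianIdeal F :=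
    Ideal.subset_span h
  refine add_mem (Ideal.mul_mem_left _ _ (self_mem_jacobianIdeal hF hirr))
    (add_mem (add_mem (add_mem ?_ ?_) ?_) ?_) <;>
    exact Ideal.mul_mem_left _ _ (hs _ (by simp))

/-- The local data of an operator on the chart `x_i y_j ≠ 0`, from those on the chart
`x₀ y₀ ≠ 0`. -/
theorem op_frame {d e : ℕ} {T : bihom d e →ₗ[ℂ] K} {R ξ η : K}
    (hT : ∀ (α : Fin 2 ⊕ Fin 2 →₀ ℕ) (hα : monomial α 1 ∈ bihom d e), T ⟨monomial α 1, hα⟩ =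
      algebraMap S K (monomial α 1) * (R + α (.inl 1) * ξ + α (.inr 1) * η)) (i j : Fin 2) :
    T (frame d e i j) = algebraMap S K (frame d e i j) *
      (R + (if i = 1 then d * ξ else 0) + (if j = 1 then e * η else 0)) := by
  have hmon : (frame d e i j : S) =
      monomial (Finsupp.single (.inl i) d + Finsupp.single (.inr j) e) 1 := by
    rw [coe_frame, X_pow_eq_monomial, X_pow_eq_monomial, monomial_mul, one_mul]
  have hα := hmon ▸ (frame d e i j).2
  have hframe : frame d e i j = ⟨_, hα⟩ := Subtype.ext hmon
  rw [hframe, hT]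
  congr 1
  fin_cases i <;> fin_cases j <;> simp

/-- The value of a regular first-order operator on `F` is a form in the Jacobian ideal of `F`. -/
theorem IsRegularOp.exists_mem_jacobianIdeal {d e : ℕ} {a b : ℤ} {T : ratSec d e →ₗ[ℂ] K}
    (hT : IsRegularOp a b T) {F : S} (hF : F ∈ bihom d e) (hirr : Irreducible F) :
    ∃ G ∈ bihom a b, G ∈ jacobianIdeal F ∧ T (polyRat d e ⟨F, hF⟩) = algebraMap S K G := by
  obtain ⟨G, hG, hGT⟩ := exists_poly_of_regular fun P =>
    hT.regular P _ (regularAt_polyRat P ⟨F, hF⟩)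
  refine ⟨G, hG, ?_, hGT⟩
  have h00 (i j : Fin 2) : algebraMap S K (frame d e i j) ≠ 0 := by
    simpa using frame_ne_zero d e i j
  obtain ⟨X, hX⟩ := hT.exists_symbol (polyRat d e (frame d e 0 0))
    (by rw [coe_polyRat]; exact h00 0 0)
  have hx : bidegree (.inl 1) = bidegree (.inl 0) := rfl
  have hy : bidegree (.inr 1) = bidegree (.inr 0) := rfl
  have hmono (α : Fin 2 ⊕ Fin 2 →₀ ℕ) (hα : monomial α 1 ∈ bihom d e) :
      T.comp (polyRat d e) ⟨monomial α 1, hα⟩ = _ := op_monomial hX hx hy hα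
  refine mem_jacobianIdeal_of_local_data (m := a - d) (n := b - e) hF hirr (fun P i j hi hj => ?_)
    (fun P => ?_) (fun P => ?_) (hGT.symm.trans (op_eq_of_monomial hmono ⟨F, hF⟩))
  · have h1 := op_frame hmono i j
    rw [mul_comm, ← div_eq_iff (h00 i j)] at h1
    rw [← h1]
    refine IsQuot.div (nonzeroAt_mul P) (hT.regular P _ (regularAt_polyRat P (frame d e i j)))
      (frame d e i j).2 (frame_ne_zero d e i j) (valAt_frame_ne_zero d e hi hj) ?_ ?_ <;> ring
  · have h := symbol_ratio_regular hT hX hx (fun P => ?_) P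
    · simpa [bidegree] using h
    · obtain ⟨i, hi⟩ := exists_x_ne_zero P
      fin_cases i
      exacts [.inl hi, .inr hi]
  · have h := symbol_ratio_regular hT hX hy (fun P => ?_) P
    · simpa [bidegree] using h
    · obtain ⟨i, hi⟩ := exists_y_ne_zero P
      fin_cases i
      exacts [.inl hi, .inr hi]

theorem genJacobian_le_map_idealPart {d e : ℤ} {F : S} (hF : F ∈ bihom d e)
    (hirr : Irreducible F) (a b : ℤ) : genJacobian a b (polySec d e ⟨F, hF⟩) ≤
      (idealPart (jacobianIdeal F) a b).map (polySec a b) := by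
  obtain ⟨hd, he⟩ := nonneg_of_mem_bihom hF hirr.ne_zero
  lift d to ℕ using hd
  lift e to ℕ using he
  rintro _ ⟨⟨t, ht⟩, rfl⟩
  obtain ⟨G, hG, hGJ, h⟩ := (isRegularOp_opOfTensor ht).exists_mem_jacobianIdeal hF hirr
  exact ⟨⟨G, hG⟩, hGJ, Subtype.ext (Subtype.ext h.symm)⟩

end P1P1

end

theorem lemma4p1 (d e : ℤ) (F : P1P1.S) (hF : F ∈ P1P1.bihom d e) (hirr : Irreducible F)
    (a b : ℤ) :
    P1P1.genJacobian a b (P1P1.polySec d e ⟨F, hF⟩) =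
        (P1P1.idealPart (P1P1.jacobianIdeal F) a b).map (P1P1.polySec a b) ∧
      ∀ G : P1P1.bihom a b, G ∈ P1P1.idealPart (P1P1.jacobianIdeal F) a b ↔
        ∃ P₀ ∈ P1P1.bihom (a - d + 1) (b - e), ∃ P₁ ∈ P1P1.bihom (a - d + 1) (b - e),
        ∃ Q₀ ∈ P1P1.bihom (a - d) (b - e + 1), ∃ Q₁ ∈ P1P1.bihom (a - d) (b - e + 1),
          (G : P1P1.S) = P₀ * P1P1.dx 0 F + P₁ * P1P1.dx 1 F + Q₀ * P1P1.dy 0 F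
            + Q₁ * P1P1.dy 1 F := by
  exact ⟨le_antisymm (P1P1.genJacobian_le_map_idealPart hF hirr a b)
    (P1P1.map_idealPart_le_genJacobian hF a b), fun G => P1P1.mem_jacobianIdeal_iff hF G.2⟩
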